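/- Setting. Let $(\overline M,\overline g)$ be a smooth finite-dimensional semi-Riemannian manifold ($\overline g$ smooth, symmetric, nondegenerate, of constant index) of constant sectional curvature $c$, with Levi-Civita connection $\overline\nabla$. Let $M$ be a smooth manifold with $\dim M=\dim\overline M-1$, immersed in $\overline M$, such that the radical $\mathrm{Rad}\,TM=TM\cap TM^{\perp}$ of the induced metric $g$ is a smooth distribution of rank one; that is, $(M,g)$ is a lightlike hypersurface. (Manifolds are Hausdorff and without boundary.) A *screen distribution* is a smooth distribution $S(TM)$ with $TM=\mathrm{Rad}\,TM\oplus S(TM)$. A *normalizing pair* of $S(TM)$ is a pair $(\xi,N)$ with $\xi\in\mathrm{Rad}\,TM$, $\overline g(N,\xi)=1$, $\overline g(N,N)=0$ and $\overline g(N,s)=0$ for all $s\in S(TM)$; the vectors $N$ span a line bundle $\mathrm{tr}(TM)$ along $M$ with $T\overline M|_M=TM\oplus \mathrm{tr}(TM)$. For $X,Y\in\Gamma(TM)$, the induced connection $\nabla_XY$ is the component of $\overline\nabla_XY$ in $TM$, and $A_NX$ is minus the component of $\overline\nabla_XN$ in $TM$. The vector field $A_N\xi$ depends only on $S(TM)$,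 not on the normalizing pair. Put $R(X,Y)=\nabla_X\nabla_Y-\nabla_Y\nabla_X-\nabla_{[X,Y]}$ and $R(X,Y,Z,W)=g(R(X,Y)Z,W)$. The screen is *admissible* if $R$ is an algebraic curvature tensor: $$R(X,Y,Z,W)=-R(Y,X,Z,W)=R(Z,W,X,Y),\qquad R(X,Y,Z,W)+R(Y,Z,X,W)+R(Z,X,Y,W)=0 .$$ For an admissible screen and $x\in T_uM$ with $g(x,x)=\pm1$, the pseudo-Jacobi operator $J_R(x):T_uM\to T_uM$ is defined by $\tilde g(J_R(x)y,w)=R(y,x,x,w)$ for all $y,w\in T_uM$, where $\tilde g(y,w)=g(y,w)+\overline g(N,y)\,\overline g(N,w)$ is nondegenerate. $M$ is spacelike (resp. timelike) Osserman at $u$ if for each admissible screen the characteristic polynomial of $J_R(x)$ is the same for all $x\in T_uM$ with $g(x,x)=1$ (resp. $g(x,x)=-1$), and *pointwise Osserman* if at each point $u$ it is spacelike or timelike Osserman. Statement. Let $(M,g)$ be a pointwise Osserman lightlike hypersurface of $(\overline M,\overline g)$ as above, and let $S(TM)$ be an admissible screen distribution for which the vector field $A_N\xi$ is nowhere null, i.e.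 $g(A_N\xi,A_N\xi)\neq0$ at every point of $M$. Then $(M,g,S(TM))$ is locally symmetric, i.e. $$(\nabla_WR)(X,Y)Z=0\qquad\text{for all }W,X,Y,Z\in\Gamma(TM),$$ if and only if it is semi-symmetric, i.e. for all $V_1,V_2,X,Y,Z,T\in\Gamma(TM)$, $$(R(V_1,V_2)\cdot R)(X,Y,Z,T):=-R(R(V_1,V_2)X,Y,Z,T)-R(X,R(V_1,V_2)Y,Z,T)-R(X,Y,R(V_1,V_2)Z,T)-R(X,Y,Z,R(V_1,V_2)T)=0 .$$ -/

import Mathlib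

open scoped Manifold ContDiff Bundle

noncomputable section

namespace LightlikeGeometry

variable {E : Type*} [NormedAddCommGroup E] [NormedSpace ℝ E]
  {M : Type*} [TopologicalSpace M] [ChartedSpace E M]
  {F : Type*} [NormedAddCommGroup F] [NormedSpace ℝ F]
  {N : Type*} [TopologicalSpace N] [ChartedSpace F N]

instance instFiniteDimensionalTangentSpace [FiniteDimensional ℝ E] (u : M) :
    FiniteDimensional ℝ (TangentSpace 𝓘(ℝ, E) u) :=
  inferInstanceAs (FiniteDimensional ℝ E)

/-- A (not necessarily continuous) vector field on `M`. -/
abbrev VField (E : Type*) [NormedAddCommGroup E] [NormedSpace ℝ E]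
    (M : Type*) [TopologicalSpace M] [ChartedSpace E M] : Type _ :=
  Π u : M, TangentSpace 𝓘(ℝ, E) u

/-- The vector field `X` is smooth on the set `U`. -/
def SmoothFieldOn [IsManifold 𝓘(ℝ, E) ∞ M] (X : VField E M) (U : Set M) : Prop :=
  ContMDiffOn 𝓘(ℝ, E) 𝓘(ℝ, E).tangent ∞ (fun u => (⟨u, X u⟩ : TangentBundle 𝓘(ℝ, E) M)) U

/-- `X ∈ Γ(TM)`: the vector field `X` is smooth on all of `M`. -/
def SmoothField [IsManifold 𝓘(ℝ, E) ∞ M] (X : VField E M) : Prop :=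
  ContMDiff 𝓘(ℝ, E) 𝓘(ℝ, E).tangent ∞ (fun u => (⟨u, X u⟩ : TangentBundle 𝓘(ℝ, E) M))

/-- The curvature operator `R(X,Y)Z = D_X D_Y Z - D_Y D_X Z - D_[X,Y] Z` of an operator
`D X Y = D_X Y` on vector fields. -/
def curvatureOp (D : VField E M → VField E M → VField E M) (X Y Z : VField E M) : VField E M :=
  D X (D Y Z) - D Y (D X Z) - D (VectorField.mlieBracket 𝓘(ℝ, E) X Y) Z

/-! ### The ambient semi-Riemannian manifold -/

/-- The bilinear form underlying a continuous bilinear form on a tangent space. -/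
def toBilin {p : N}
    (b : TangentSpace 𝓘(ℝ, F) p →L[ℝ] TangentSpace 𝓘(ℝ, F) p →L[ℝ] ℝ) :
    LinearMap.BilinForm ℝ (TangentSpace 𝓘(ℝ, F) p) :=
  LinearMap.mk₂ ℝ (fun v w => b v w) (by simp) (by simp) (by simp) (by simp)

/-- A semi-Riemannian metric: a smooth, symmetric, nondegenerate `(0,2)`-tensor field of constant
index (the index at `p` is the largest dimension of a negative definite subspace of `T_p N`). -/
structure SemiRiemannianMetric (F : Type*) [NormedAddCommGroup F] [NormedSpace ℝ F]
    (N : Type*) [TopologicalSpace N] [ChartedSpace F N] [IsManifold 𝓘(ℝ, F) ∞ N] where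
  val (p : N) : TangentSpace 𝓘(ℝ, F) p →L[ℝ] TangentSpace 𝓘(ℝ, F) p →L[ℝ] ℝ
  symm (p : N) (v w : TangentSpace 𝓘(ℝ, F) p) : val p v w = val p w v
  nondegenerate (p : N) (v : TangentSpace 𝓘(ℝ, F) p) : (∀ w, val p v w = 0) → v = 0
  constant_index (p q : N) :
    sigNeg (LinearMap.BilinMap.toQuadraticMap (toBilin (val p))) =
      sigNeg (LinearMap.BilinMap.toQuadraticMap (toBilin (val q)))
  contMDiff : ContMDiff 𝓘(ℝ, F) (𝓘(ℝ, F).prod 𝓘(ℝ, F →L[ℝ] F →L[ℝ] ℝ)) ∞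
    (fun p => Bundle.TotalSpace.mk' (F →L[ℝ] F →L[ℝ] ℝ)
      (E := fun p : N => TangentSpace 𝓘(ℝ, F) p →L[ℝ] TangentSpace 𝓘(ℝ, F) p →L[ℝ] ℝ)
      p (val p))

/-- A linear connection on the tangent bundle of `N`; `D Y p (X p)` is `(D_X Y)(p)`. -/
abbrev Connection (F : Type*) [NormedAddCommGroup F] [NormedSpace ℝ F]
    (N : Type*) [TopologicalSpace N] [ChartedSpace F N] [IsManifold 𝓘(ℝ, F) ∞ N] : Type _ :=
  CovariantDerivative 𝓘(ℝ, F) F (TangentSpace 𝓘(ℝ, F) : N → Type _)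

/-- `D` is the Levi-Civita connection of `g`: the (smooth) linear connection which is torsion-free
and for which `g` is parallel. -/
structure IsLeviCivita [FiniteDimensional ℝ F] [IsManifold 𝓘(ℝ, F) ∞ N]
    (g : SemiRiemannianMetric F N) (D : Connection F N) : Prop where
  smooth : CovariantDerivative.ContMDiffCovariantDerivative D ∞
  torsion_eq_zero : D.torsion = 0
  metric (Y Z : VField F N) (p : N)
    (hY : MDifferentiableAt 𝓘(ℝ, F) 𝓘(ℝ, F).tangent
      (fun q => (⟨q, Y q⟩ : TangentBundle 𝓘(ℝ, F) N)) p)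
    (hZ : MDifferentiableAt 𝓘(ℝ, F) 𝓘(ℝ, F).tangent
      (fun q => (⟨q, Z q⟩ : TangentBundle 𝓘(ℝ, F) N)) p)
    (v : TangentSpace 𝓘(ℝ, F) p) :
    mvfderiv 𝓘(ℝ, F) (fun q => g.val q (Y q) (Z q)) p v =
      g.val p (D Y p v) (Z p) + g.val p (Y p) (D Z p v)

/-- Constant sectional curvature `c`: the sectional curvature
`g(R(X,Y)Y,X) / (g(X,X) g(Y,Y) - g(X,Y)²)` of every nondegenerate tangent plane equals `c`. -/
def HasConstantSectionalCurvature [IsManifold 𝓘(ℝ, F) ∞ N]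
    (g : SemiRiemannianMetric F N) (D : Connection F N) (c : ℝ) : Prop :=
  ∀ X Y : VField F N, SmoothField X → SmoothField Y → ∀ p : N,
    g.val p (X p) (X p) * g.val p (Y p) (Y p) - g.val p (X p) (Y p) ^ 2 ≠ 0 →
    g.val p (curvatureOp (fun V W q => D W q (V q)) X Y Y p) (X p) /
      (g.val p (X p) (X p) * g.val p (Y p) (Y p) - g.val p (X p) (Y p) ^ 2) = c

/-- The covariant derivative `D_x V` along `f : M → N` of a vector field `V` along `f`, in the
direction `x ∈ T_u M`. In a trivialization of `TN` around `f u`, the first term differentiates the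
components of `V`; the second one is the derivative in the direction `df(x)` of the vector field on
`N` whose components are constant, with value `V u` at `f u`. Thus `D_x (Y ∘ f) = D_{df(x)} Y`. -/
def covAlong [IsManifold 𝓘(ℝ, F) ∞ N] (D : Connection F N) (f : M → N)
    (V : Π u : M, TangentSpace 𝓘(ℝ, F) (f u)) (u : M) (x : TangentSpace 𝓘(ℝ, E) u) :
    TangentSpace 𝓘(ℝ, F) (f u) :=
  (trivializationAt F (TangentSpace 𝓘(ℝ, F) : N → Type _) (f u)).symm (f u)
      (mvfderiv 𝓘(ℝ, E) (fun u' : M =>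
        (trivializationAt F (TangentSpace 𝓘(ℝ, F) : N → Type _) (f u) ⟨f u', V u'⟩).2) u x) +
    D (FiberBundle.extend F (V u)) (f u) (mfderiv 𝓘(ℝ, E) 𝓘(ℝ, F) f u x)

/-! ### Lightlike hypersurfaces and screens -/

section Hypersurface

variable [IsManifold 𝓘(ℝ, E) ∞ M] [IsManifold 𝓘(ℝ, F) ∞ N]

/-- The metric `g` induced on `M` by `f : M → N`. -/
def indMetric (g : SemiRiemannianMetric F N) (f : M → N) (u : M)
    (x y : TangentSpace 𝓘(ℝ, E) u) : ℝ :=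
  g.val (f u) (mfderiv 𝓘(ℝ, E) 𝓘(ℝ, F) f u x) (mfderiv 𝓘(ℝ, E) 𝓘(ℝ, F) f u y)

/-- The radical `Rad T_u M = {x ∈ T_u M | g(x, y) = 0 for all y ∈ T_u M}`. -/
def radical (g : SemiRiemannianMetric F N) (f : M → N) (u : M) :
    Submodule ℝ (TangentSpace 𝓘(ℝ, E) u) where
  carrier := {x | ∀ y, indMetric g f u x y = 0}
  add_mem' := by
    intro a b ha hb y
    have h1 := ha y
    have h2 := hb y
    simp only [indMetric] at h1 h2 ⊢
    simp [h1, h2]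
  zero_mem' := by
    intro y
    simp [indMetric]
  smul_mem' := by
    intro c a ha y
    have h1 := ha y
    simp only [indMetric] at h1 ⊢
    simp [h1]

/-- `S` is a smooth distribution of rank `k` on `M`: locally it has a smooth frame. -/
def IsSmoothDistribution (k : ℕ) (S : Π u : M, Submodule ℝ (TangentSpace 𝓘(ℝ, E) u)) : Prop :=
  ∀ u₀ : M, ∃ U : Set M, IsOpen U ∧ u₀ ∈ U ∧ ∃ X : Fin k → VField E M,
    (∀ i, SmoothFieldOn (X i) U) ∧
    ∀ u ∈ U, LinearIndependent ℝ (fun i => X i u) ∧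
      Submodule.span ℝ (Set.range fun i => X i u) = S u

/-- `f : M → N` is a lightlike hypersurface: an immersion of codimension one, the radical of whose
induced metric is a smooth distribution of rank one. -/
structure IsLightlikeHypersurface (g : SemiRiemannianMetric F N) (f : M → N) : Prop where
  smooth : ContMDiff 𝓘(ℝ, E) 𝓘(ℝ, F) ∞ f
  immersion (u : M) : Function.Injective (mfderiv 𝓘(ℝ, E) 𝓘(ℝ, F) f u)
  codim_one : Module.finrank ℝ F = Module.finrank ℝ E + 1
  radical_rank_one : IsSmoothDistribution 1 (fun u : M => radical (E := E) g f u)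

/-- `S` is a screen distribution: a smooth distribution complementary to the radical. (The induced
metric is then automatically nondegenerate on `S`.) -/
def IsScreen (g : SemiRiemannianMetric F N) (f : M → N)
    (S : Π u : M, Submodule ℝ (TangentSpace 𝓘(ℝ, E) u)) : Prop :=
  (∃ k, IsSmoothDistribution k S) ∧ ∀ u, IsCompl (radical g f u) (S u)

variable (g : SemiRiemannianMetric F N) (D : Connection F N) (f : M → N)
  (S : Π u : M, Submodule ℝ (TangentSpace 𝓘(ℝ, E) u))

/-- `(ξ, n)` is a normalizing pair at `u`: `ξ ∈ Rad T_u M`, and `n` is a lightlike vector orthogonal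
to the screen with `g(n, ξ) = 1`. -/
structure IsNormalizingPairAt (u : M) (ξ : TangentSpace 𝓘(ℝ, E) u)
    (n : TangentSpace 𝓘(ℝ, F) (f u)) : Prop where
  mem_radical : ξ ∈ radical g f u
  pairing : g.val (f u) n (mfderiv 𝓘(ℝ, E) 𝓘(ℝ, F) f u ξ) = 1
  null : g.val (f u) n n = 0
  orthogonal (s : TangentSpace 𝓘(ℝ, E) u) (hs : s ∈ S u) :
    g.val (f u) n (mfderiv 𝓘(ℝ, E) 𝓘(ℝ, F) f u s) = 0

/-- The fibre `tr(TM)_u = ltr(TM)_u` of the lightlike transversal line bundle of the screen. -/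
def transversal (u : M) : Submodule ℝ (TangentSpace 𝓘(ℝ, F) (f u)) :=
  Submodule.span ℝ {n | ∃ ξ, IsNormalizingPairAt g f S u ξ n}

/-- The tangential part of `w` in `T_{f u} N = df(T_u M) ⊕ tr(TM)_u`: the unique `x ∈ T_u M` with
`w - df(x) ∈ tr(TM)_u`. -/
def tanPart (u : M) (w : TangentSpace 𝓘(ℝ, F) (f u)) : TangentSpace 𝓘(ℝ, E) u :=
  Classical.epsilon fun x => w - mfderiv 𝓘(ℝ, E) 𝓘(ℝ, F) f u x ∈ transversal g f S u

/-- The induced connection `∇_X Y`: the tangential part of the ambient derivative of `Y` (Gauss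
formula). -/
def indConn (X Y : VField E M) : VField E M := fun u =>
  tanPart g f S u
    (covAlong D f (fun u' => mfderiv 𝓘(ℝ, E) 𝓘(ℝ, F) f u' (Y u')) u (X u))

/-- The shape operator `A_V` of a field `V` along `f`: `-A_V x` is the tangential part of the
ambient derivative of `V` (Weingarten formula). -/
def shapeOp (V : Π u : M, TangentSpace 𝓘(ℝ, F) (f u)) (u : M) (x : TangentSpace 𝓘(ℝ, E) u) :
    TangentSpace 𝓘(ℝ, E) u :=
  -tanPart g f S u (covAlong D f V u x)

/-- The induced curvature operator `R(X,Y)Z` of `(M, g, S)`. -/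
def indCurv (X Y Z : VField E M) : VField E M :=
  curvatureOp (indConn g D f S) X Y Z

/-- The induced `(0,4)` curvature tensor `R(X,Y,Z,W) = g(R(X,Y)Z, W)`. -/
def indCurv4 (X Y Z W : VField E M) : M → ℝ := fun u =>
  indMetric g f u (indCurv g D f S X Y Z u) (W u)

/-- The screen distribution `S` is admissible: its induced curvature tensor is an algebraic
curvature tensor. -/
structure IsAdmissible : Prop where
  isScreen : IsScreen g f S
  antisymm (X Y Z W : VField E M) (hX : SmoothField X) (hY : SmoothField Y)
    (hZ : SmoothField Z) (hW : SmoothField W) :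
    indCurv4 g D f S X Y Z W = -indCurv4 g D f S Y X Z W
  pair_symm (X Y Z W : VField E M) (hX : SmoothField X) (hY : SmoothField Y)
    (hZ : SmoothField Z) (hW : SmoothField W) :
    indCurv4 g D f S X Y Z W = indCurv4 g D f S Z W X Y
  bianchi (X Y Z W : VField E M) (hX : SmoothField X) (hY : SmoothField Y)
    (hZ : SmoothField Z) (hW : SmoothField W) :
    indCurv4 g D f S X Y Z W + indCurv4 g D f S Y Z X W + indCurv4 g D f S Z X Y W = 0

/-- The nondegenerate metric `g(x,y) + η(x) η(y)`, `η = g(n, ·)`, associated with a vector `n`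
transversal to `M` at `u`. -/
def assocMetric (u : M) (n : TangentSpace 𝓘(ℝ, F) (f u)) (x y : TangentSpace 𝓘(ℝ, E) u) : ℝ :=
  indMetric g f u x y +
    g.val (f u) n (mfderiv 𝓘(ℝ, E) 𝓘(ℝ, F) f u x) *
      g.val (f u) n (mfderiv 𝓘(ℝ, E) 𝓘(ℝ, F) f u y)

/-- `J` is the pseudo-Jacobi operator `J_R(x)` on `T_u M`, defined with the associated metric `g̃`
of a normalizing pair `(ξ, n)` by `g̃(J_R(x) y, w) = R(y, x, x, w)`. The vectors `x`, `y`, `w` are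
represented by the values at `u` of smooth vector fields `X`, `Y`, `W`. -/
def IsPseudoJacobi (u : M) (n : TangentSpace 𝓘(ℝ, F) (f u)) (x : TangentSpace 𝓘(ℝ, E) u)
    (J : TangentSpace 𝓘(ℝ, E) u →ₗ[ℝ] TangentSpace 𝓘(ℝ, E) u) : Prop :=
  ∀ X Y W : VField E M, SmoothField X → SmoothField Y → SmoothField W → X u = x →
    assocMetric g f u n (J (Y u)) (W u) = indCurv4 g D f S Y X X W u

/-- `M` is spacelike (`ε = 1`) or timelike (`ε = -1`) Osserman at `u`: for each admissible screen,
the characteristic polynomial of `J_R(x)` is the same for all `x ∈ T_u M` with `g(x,x) = ε`. -/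
def IsOssermanAt [FiniteDimensional ℝ E] (ε : ℝ) (u : M) : Prop :=
  ∀ S' : (Π u : M, Submodule ℝ (TangentSpace 𝓘(ℝ, E) u)), IsAdmissible g D f S' →
    ∀ (ξ : TangentSpace 𝓘(ℝ, E) u) (n : TangentSpace 𝓘(ℝ, F) (f u)),
      IsNormalizingPairAt g f S' u ξ n →
      ∃ P : Polynomial ℝ, ∀ x : TangentSpace 𝓘(ℝ, E) u, indMetric g f u x x = ε →
        ∀ J : TangentSpace 𝓘(ℝ, E) u →ₗ[ℝ] TangentSpace 𝓘(ℝ, E) u,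
          IsPseudoJacobi g D f S' u n x J → J.charpoly = P

/-- `M` is pointwise Osserman: at every point it is spacelike or timelike Osserman. -/
def IsPointwiseOsserman [FiniteDimensional ℝ E] : Prop :=
  ∀ u : M, IsOssermanAt (E := E) g D f 1 u ∨ IsOssermanAt (E := E) g D f (-1) u

/-- `A_N ξ` is a non-null vector field: around every point there is a smooth normalizing pair
`(ξ, N)` with `g(A_N ξ, A_N ξ) ≠ 0` everywhere. (The vector field `A_N ξ` does not depend on the
normalizing pair, only on the screen.) -/
def ShapeXiNonNull : Prop :=
  ∀ u₀ : M, ∃ U : Set M, IsOpen U ∧ u₀ ∈ U ∧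
    ∃ (ξ : VField E M) (n : Π u : M, TangentSpace 𝓘(ℝ, F) (f u)),
      SmoothFieldOn ξ U ∧
      ContMDiffOn 𝓘(ℝ, E) 𝓘(ℝ, F).tangent ∞
        (fun u => (⟨f u, n u⟩ : TangentBundle 𝓘(ℝ, F) N)) U ∧
      ∀ u ∈ U, IsNormalizingPairAt g f S u (ξ u) (n u) ∧
        indMetric g f u (shapeOp g D f S n u (ξ u)) (shapeOp g D f S n u (ξ u)) ≠ 0

/-- `(M, g, S)` is locally symmetric: `(∇_W R)(X,Y)Z = 0` for all `X, Y, Z, W ∈ Γ(TM)`. -/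
def IsLocallySymmetric : Prop :=
  ∀ W X Y Z : VField E M, SmoothField W → SmoothField X → SmoothField Y → SmoothField Z →
    indConn g D f S W (indCurv g D f S X Y Z)
      - indCurv g D f S (indConn g D f S W X) Y Z
      - indCurv g D f S X (indConn g D f S W Y) Z
      - indCurv g D f S X Y (indConn g D f S W Z) = 0

/-- `(M, g, S)` is semi-symmetric: `(R(V₁,V₂) · R)(X,Y,Z,T) = 0` for all vector fields in `Γ(TM)`,
where `R(V₁,V₂)` acts as a derivation on the `(0,4)` curvature tensor. -/
def IsSemiSymmetric : Prop :=
  ∀ V₁ V₂ X Y Z T : VField E M, SmoothField V₁ → SmoothField V₂ →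
    SmoothField X → SmoothField Y → SmoothField Z → SmoothField T →
    -indCurv4 g D f S (indCurv g D f S V₁ V₂ X) Y Z T
      - indCurv4 g D f S X (indCurv g D f S V₁ V₂ Y) Z T
      - indCurv4 g D f S X Y (indCurv g D f S V₁ V₂ Z) T
      - indCurv4 g D f S X Y Z (indCurv g D f S V₁ V₂ T) = 0

end Hypersurface

end LightlikeGeometry

end

/-! Both properties hold under the hypotheses, so the equivalence is one between true statements.
Let B(Y,Z) = g(D_Y Z, ξ) be the second fundamental form for a local normalizing pair (ξ, N).
Constant ambient curvature gives the Gauss equation (`IsNormalizingPairNear.gauss_equation`) R(X,Y)Z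
= c (g(Y,Z) X - g(X,Z) Y) + B(Y,Z) A_N X - B(X,Z) A_N Y. Since ξ is radical, B vanishes when either
argument is ξ: metric compatibility gives B(·,ξ) = 0, and vanishing torsion then gives B(ξ,·) = 0.
Hence R(ξ,Y,Z,W) = B(Y,Z) g(A_N ξ, W), while R(Z,W)ξ = 0. The pair symmetry of an admissible screen
equates R(ξ,Y,Z,W) with R(Z,W,ξ,Y) = 0, and W = A_N ξ, which is non-null, forces B = 0
(`secondForm_eq_zero`).

With B = 0 the induced connection is the restriction of the ambient one, hence compatible with g,
and R(X,Y)Z = c (g(Y,Z) X - g(X,Z) Y). Such an R is parallel by the Leibniz rule. It is also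
annihilated by each R(V₁,V₂), because these operators are skew for g.

Most of the work lies in the calculus along f needed for the Gauss equation. Near a point every
smooth field along f is a combination, with function coefficients, of fields Y ∘ f
(`SmoothAlongNear.induction`). This carries compatibility with the metric, vanishing torsion and the
curvature formula from the ambient manifold to `covAlong`. The ambient curvature tensor is itself
recovered from the sectional curvatures by polarization
(`HasConstantSectionalCurvature.connCurv_eq`). -/

noncomputable section

namespace LightlikeGeometry

open scoped Topology
open Bundle Filter

/-! ### Germs of smooth functions and fields; linearity and Leibniz rule for the derivative along a
map. -/

section

variable {E : Type*} [NormedAddCommGroup E] [NormedSpace ℝ E]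
  {M : Type*} [TopologicalSpace M] [ChartedSpace E M]
  {F : Type*} [NormedAddCommGroup F] [NormedSpace ℝ F]
  {N : Type*} [TopologicalSpace N] [ChartedSpace F N]
  {G : Type*} [NormedAddCommGroup G] [NormedSpace ℝ G]

/-- The function `a` is smooth on a neighbourhood of `u`. -/
def SmoothFunNear (a : M → G) (u : M) : Prop :=
  ∀ᶠ u' in 𝓝 u, ContMDiffAt 𝓘(ℝ, E) 𝓘(ℝ, G) ∞ a u'

/-- The vector field `V` along `f` is smooth on a neighbourhood of `u`. -/
def SmoothAlongNear [IsManifold 𝓘(ℝ, F) ∞ N] (f : M → N)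
    (V : Π u : M, TangentSpace 𝓘(ℝ, F) (f u)) (u : M) : Prop :=
  ∀ᶠ u' in 𝓝 u, ContMDiffAt 𝓘(ℝ, E) 𝓘(ℝ, F).tangent ∞
    (fun x => (⟨f x, V x⟩ : TangentBundle 𝓘(ℝ, F) N)) u'

/-- The vector field `X` is smooth on a neighbourhood of `u`. -/
def SmoothFieldNear [IsManifold 𝓘(ℝ, E) ∞ M] (X : VField E M) (u : M) : Prop :=
  ∀ᶠ u' in 𝓝 u, ContMDiffAt 𝓘(ℝ, E) 𝓘(ℝ, E).tangent ∞
    (fun x => (⟨x, X x⟩ : TangentBundle 𝓘(ℝ, E) M)) u'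

lemma SmoothField.near [IsManifold 𝓘(ℝ, E) ∞ M] {X : VField E M} (hX : SmoothField X) (u : M) :
    SmoothFieldNear X u := Eventually.of_forall hX

lemma SmoothFunNear.eventually {a : M → G} {u : M} (h : SmoothFunNear (E := E) a u) :
    ∀ᶠ u' in 𝓝 u, SmoothFunNear (E := E) a u' := eventually_eventually_nhds.2 h

lemma SmoothFunNear.at {a : M → G} {u : M} (h : SmoothFunNear (E := E) a u) :
    ContMDiffAt 𝓘(ℝ, E) 𝓘(ℝ, G) ∞ a u := h.self_of_nhds

lemma SmoothFunNear.mdiff {a : M → G} {u : M} (h : SmoothFunNear (E := E) a u) :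
    MDifferentiableAt 𝓘(ℝ, E) 𝓘(ℝ, G) a u := h.at.mdifferentiableAt (by simp)

lemma SmoothFieldNear.at [IsManifold 𝓘(ℝ, E) ∞ M] {X : VField E M} {u : M}
    (h : SmoothFieldNear X u) : ContMDiffAt 𝓘(ℝ, E) 𝓘(ℝ, E).tangent ∞
    (fun x => (⟨x, X x⟩ : TangentBundle 𝓘(ℝ, E) M)) u := h.self_of_nhds

lemma SmoothFieldNear.mdiff [IsManifold 𝓘(ℝ, E) ∞ M] {X : VField E M} {u : M}
    (h : SmoothFieldNear X u) : MDifferentiableAt 𝓘(ℝ, E) 𝓘(ℝ, E).tangent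
    (fun x => (⟨x, X x⟩ : TangentBundle 𝓘(ℝ, E) M)) u := h.at.mdifferentiableAt (by simp)

lemma SmoothFieldNear.eventually [IsManifold 𝓘(ℝ, E) ∞ M] {X : VField E M} {u : M}
    (h : SmoothFieldNear X u) : ∀ᶠ u' in 𝓝 u, SmoothFieldNear X u' :=
  eventually_eventually_nhds.2 h

section Along

variable [IsManifold 𝓘(ℝ, F) ∞ N] {f : M → N} {u : M}
  {V W : Π u : M, TangentSpace 𝓘(ℝ, F) (f u)} {a : M → ℝ}

lemma SmoothAlongNear.eventually (h : SmoothAlongNear (E := E) f V u) :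
    ∀ᶠ u' in 𝓝 u, SmoothAlongNear (E := E) f V u' := eventually_eventually_nhds.2 h

lemma SmoothAlongNear.at (h : SmoothAlongNear (E := E) f V u) :
    ContMDiffAt 𝓘(ℝ, E) 𝓘(ℝ, F).tangent ∞
      (fun x => (⟨f x, V x⟩ : TangentBundle 𝓘(ℝ, F) N)) u := h.self_of_nhds

lemma SmoothAlongNear.congr (h : SmoothAlongNear (E := E) f V u) (hVW : ∀ᶠ x in 𝓝 u, V x = W x) :
    SmoothAlongNear (E := E) f W u := by
  filter_upwards [h, eventually_eventually_nhds.2 hVW] with y hy hy'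
  refine hy.congr_of_eventuallyEq ?_
  filter_upwards [hy'] with z hz
  rw [hz]

/-- The components of a vector field along `f`, in the trivialization around `f u`. -/
def alongComp (f : M → N) (V : Π u : M, TangentSpace 𝓘(ℝ, F) (f u)) (u : M) (x : M) : F :=
  (trivializationAt F (TangentSpace 𝓘(ℝ, F) : N → Type _) (f u) ⟨f x, V x⟩).2

lemma contMDiffAt_along_iff :
    ContMDiffAt 𝓘(ℝ, E) 𝓘(ℝ, F).tangent ∞
      (fun x => (⟨f x, V x⟩ : TangentBundle 𝓘(ℝ, F) N)) u ↔
    ContMDiffAt 𝓘(ℝ, E) 𝓘(ℝ, F) ∞ f u ∧ ContMDiffAt 𝓘(ℝ, E) 𝓘(ℝ, F) ∞ (alongComp f V u) u :=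
  contMDiffAt_totalSpace

lemma eventually_mem_baseSet (hf : ContinuousAt f u) :
    ∀ᶠ x in 𝓝 u, f x ∈ (trivializationAt F (TangentSpace 𝓘(ℝ, F) : N → Type _) (f u)).baseSet :=
  hf ((trivializationAt F (TangentSpace 𝓘(ℝ, F) : N → Type _) (f u)).open_baseSet.mem_nhds
    (FiberBundle.mem_baseSet_trivializationAt' (f u)))

lemma alongComp_add (hf : ContinuousAt f u) :
    alongComp f (V + W : Π u : M, TangentSpace 𝓘(ℝ, F) (f u)) u =ᶠ[𝓝 u] alongComp f V u + alongComp f W u := by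
  filter_upwards [eventually_mem_baseSet (F := F) hf] with x hx
  exact ((trivializationAt F (TangentSpace 𝓘(ℝ, F) : N → Type _) (f u)).linear ℝ hx).map_add _ _

lemma alongComp_smul (hf : ContinuousAt f u) :
    alongComp f (a • V : Π u : M, TangentSpace 𝓘(ℝ, F) (f u)) u =ᶠ[𝓝 u] a • alongComp f V u := by
  filter_upwards [eventually_mem_baseSet (F := F) hf] with x hx
  exact ((trivializationAt F (TangentSpace 𝓘(ℝ, F) : N → Type _) (f u)).linear ℝ hx).map_smul _ _

lemma SmoothAlongNear.add (hV : SmoothAlongNear (E := E) f V u)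
    (hW : SmoothAlongNear (E := E) f W u) : SmoothAlongNear (E := E) f (V + W) u := by
  filter_upwards [hV, hW] with x hx hx'
  rw [contMDiffAt_along_iff] at hx hx' ⊢
  exact ⟨hx.1, (hx.2.add hx'.2).congr_of_eventuallyEq (alongComp_add hx.1.continuousAt)⟩

lemma SmoothAlongNear.smul (ha : SmoothFunNear (E := E) a u)
    (hV : SmoothAlongNear (E := E) f V u) : SmoothAlongNear (E := E) f (a • V) u := by
  filter_upwards [hV, ha] with x hx hx'
  rw [contMDiffAt_along_iff] at hx ⊢
  exact ⟨hx.1, (hx'.smul hx.2).congr_of_eventuallyEq (alongComp_smul hx.1.continuousAt)⟩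

variable (D : Connection F N)

/-- Over the base set the fibrewise inverse of the trivialization is the continuous linear map
`symmL`, which makes the additivity and Leibniz computations available. -/
lemma covAlong_eq (x : TangentSpace 𝓘(ℝ, E) u) :
    covAlong D f V u x =
      (trivializationAt F (TangentSpace 𝓘(ℝ, F) : N → Type _) (f u)).symmL ℝ (f u)
        (mvfderiv 𝓘(ℝ, E) (alongComp f V u) u x) +
      D (FiberBundle.extend F (V u)) (f u) (mfderiv 𝓘(ℝ, E) 𝓘(ℝ, F) f u x) := by
  rw [Trivialization.symmL_apply _ (FiberBundle.mem_baseSet_trivializationAt' (f u))]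
  rfl

lemma mvfderiv_congr_of_eventuallyEq {a b : M → G} (hab : a =ᶠ[𝓝 u] b) :
    mvfderiv 𝓘(ℝ, E) a u = mvfderiv 𝓘(ℝ, E) b u := by
  have h := hab.mfderiv_eq (I := 𝓘(ℝ, E)) (I' := 𝓘(ℝ, G))
  ext x
  exact congrArg (fun L : E →L[ℝ] G => L x) h

variable {D}

lemma covAlong_congr (hVW : ∀ᶠ x in 𝓝 u, V x = W x) (x : TangentSpace 𝓘(ℝ, E) u) :
    covAlong D f V u x = covAlong D f W u x := by
  have h : alongComp f V u =ᶠ[𝓝 u] alongComp f W u := by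
    filter_upwards [hVW] with y hy
    simp only [alongComp, hy]
  rw [covAlong_eq, covAlong_eq, mvfderiv_congr_of_eventuallyEq h, hVW.self_of_nhds]

lemma mdifferentiableAt_extend {p : N} (v : TangentSpace 𝓘(ℝ, F) p) :
    MDifferentiableAt 𝓘(ℝ, F) 𝓘(ℝ, F).tangent
      (fun q => (⟨q, FiberBundle.extend F v q⟩ : TangentBundle 𝓘(ℝ, F) N)) p :=
  FiberBundle.mdifferentiableAt_extend ..

lemma extend_eventually_eq_symmL {p : N} (v : TangentSpace 𝓘(ℝ, F) p) :
    ∀ᶠ q in 𝓝 p, FiberBundle.extend F v q =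
      (trivializationAt F (TangentSpace 𝓘(ℝ, F) : N → Type _) p).symmL ℝ q
        (trivializationAt F (TangentSpace 𝓘(ℝ, F) : N → Type _) p ⟨p, v⟩).2 := by
  filter_upwards [eventually_mem_baseSet (F := F) (f := (id : N → N)) continuousAt_id] with q hq
  have hq' : q ∈ (trivializationAt F (TangentSpace 𝓘(ℝ, F) : N → Type _) p).baseSet := hq
  rw [Trivialization.symmL_apply _ hq']
  rfl

/-- `FiberBundle.extend` freezes the components in the trivialization at p, so it is additive in the
vector near p, and a connection only sees the germ of the field it differentiates. -/
lemma connection_extend_add {p : N} (v w : TangentSpace 𝓘(ℝ, F) p) :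
    D (FiberBundle.extend F (v + w)) p =
      D (FiberBundle.extend F v) p + D (FiberBundle.extend F w) p := by
  have hp := FiberBundle.mem_baseSet_trivializationAt' (F := F)
    (E := (TangentSpace 𝓘(ℝ, F) : N → Type _)) p
  rw [← D.isCovariantDerivativeOn.add (s := Set.univ) (mdifferentiableAt_extend _)
      (mdifferentiableAt_extend _) trivial]
  refine D.isCovariantDerivativeOn.congr_of_eventuallyEq (s := Set.univ) (mdifferentiableAt_extend _)
    (mdifferentiableAt_add_section (mdifferentiableAt_extend _) (mdifferentiableAt_extend _))
    univ_mem ?_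
  filter_upwards [extend_eventually_eq_symmL v, extend_eventually_eq_symmL w,
    extend_eventually_eq_symmL (v + w)] with q h1 h2 h3
  rw [Pi.add_apply, h1, h2, h3, ← map_add]
  congr 1
  exact ((trivializationAt F (TangentSpace 𝓘(ℝ, F) : N → Type _) p).linear ℝ hp).map_add _ _

lemma connection_extend_smul {p : N} (c : ℝ) (v : TangentSpace 𝓘(ℝ, F) p) :
    D (FiberBundle.extend F (c • v)) p = c • D (FiberBundle.extend F v) p := by
  have hp := FiberBundle.mem_baseSet_trivializationAt' (F := F)
    (E := (TangentSpace 𝓘(ℝ, F) : N → Type _)) p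
  rw [← D.isCovariantDerivativeOn.smul_const (s := Set.univ) _ (mdifferentiableAt_extend _) trivial]
  refine D.isCovariantDerivativeOn.congr_of_eventuallyEq (s := Set.univ) (mdifferentiableAt_extend _)
    (MDifferentiableAt.smul_section mdifferentiableAt_const (mdifferentiableAt_extend _))
    univ_mem ?_
  filter_upwards [extend_eventually_eq_symmL v, extend_eventually_eq_symmL (c • v)] with q h1 h2
  rw [Pi.smul_apply, h1, h2, ← map_smul]
  congr 1
  exact ((trivializationAt F (TangentSpace 𝓘(ℝ, F) : N → Type _) p).linear ℝ hp).map_smul _ _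

lemma SmoothAlongNear.mdiff_comp (hV : SmoothAlongNear (E := E) f V u) :
    MDifferentiableAt 𝓘(ℝ, E) 𝓘(ℝ, F) (alongComp f V u) u :=
  (contMDiffAt_along_iff.1 hV.at).2.mdifferentiableAt (by simp)

lemma SmoothAlongNear.base (hV : SmoothAlongNear (E := E) f V u) :
    ContMDiffAt 𝓘(ℝ, E) 𝓘(ℝ, F) ∞ f u := (contMDiffAt_along_iff.1 hV.at).1

lemma covAlong_add (hV : SmoothAlongNear (E := E) f V u) (hW : SmoothAlongNear (E := E) f W u)
    (x : TangentSpace 𝓘(ℝ, E) u) :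
    covAlong D f (V + W) u x = covAlong D f V u x + covAlong D f W u x := by
  rw [covAlong_eq, covAlong_eq, covAlong_eq,
    mvfderiv_congr_of_eventuallyEq (alongComp_add hV.base.continuousAt),
    mvfderiv_add hV.mdiff_comp hW.mdiff_comp, Pi.add_apply, connection_extend_add]
  simp only [add_apply, map_add]
  abel

lemma covAlong_smul (ha : SmoothFunNear (E := E) a u) (hV : SmoothAlongNear (E := E) f V u)
    (x : TangentSpace 𝓘(ℝ, E) u) :
    covAlong D f (a • V) u x = mvfderiv 𝓘(ℝ, E) a u x • V u + a u • covAlong D f V u x := by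
  have hp := FiberBundle.mem_baseSet_trivializationAt' (F := F)
    (E := (TangentSpace 𝓘(ℝ, F) : N → Type _)) (f u)
  rw [covAlong_eq, covAlong_eq,
    mvfderiv_congr_of_eventuallyEq (alongComp_smul hV.base.continuousAt),
    mvfderiv_smul ha.mdiff hV.mdiff_comp, Pi.smul_apply', connection_extend_smul]
  -- The derivative of the coefficient a multiplies the components of V; going back through the
  -- trivialization turns these into V u itself.
  have : (trivializationAt F (TangentSpace 𝓘(ℝ, F) : N → Type _) (f u)).symmL ℝ (f u)
      (alongComp f V u u) = V u := by
    rw [Trivialization.symmL_apply _ hp]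
    exact Trivialization.symm_apply_apply_mk _ hp _
  simp only [add_apply, smul_apply, map_add, map_smul,
    smul_add, ContinuousLinearMap.smulRight_apply, this]
  abel

end Along

end

/-! ### Extension of germs to global fields, and generation of fields along a map by ambient fields.
-/

section

variable {E : Type*} [NormedAddCommGroup E] [NormedSpace ℝ E]
  {M : Type*} [TopologicalSpace M] [ChartedSpace E M]
  {F : Type*} [NormedAddCommGroup F] [NormedSpace ℝ F]
  {N : Type*} [TopologicalSpace N] [ChartedSpace F N]
  {G : Type*} [NormedAddCommGroup G] [NormedSpace ℝ G]

section

variable [IsManifold 𝓘(ℝ, F) ∞ N] {f : M → N}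

lemma SmoothField.comp_along {Y : VField F N} (hY : SmoothField Y)
    (hf : ContMDiff 𝓘(ℝ, E) 𝓘(ℝ, F) ∞ f) (u : M) :
    SmoothAlongNear (E := E) f (fun x => Y (f x)) u :=
  Eventually.of_forall fun x => (hY (f x)).comp x hf.contMDiffAt

end

section Extension

variable [FiniteDimensional ℝ E] [T2Space M] [IsManifold 𝓘(ℝ, E) ∞ M]

/-- A bump function supported where X is smooth cuts X off without changing its germ at u. Needed
because curvature, screen and Osserman conditions are tested on globally smooth fields. -/
lemma SmoothFieldNear.exists_smoothField {X : VField E M} {u : M} (hX : SmoothFieldNear X u) :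
    ∃ Y : VField E M, SmoothField Y ∧ ∀ᶠ x in 𝓝 u, Y x = X x := by
  obtain ⟨φ, hφ⟩ := ((SmoothBumpFunction.nhds_basis_tsupport (I := 𝓘(ℝ, E)) u).mem_iff).1 hX
  refine ⟨fun x => φ x • X x, fun x => ?_, ?_⟩
  · by_cases hx : x ∈ tsupport φ
    · exact ContMDiffAt.smul_section φ.contMDiffAt (hφ.2 hx)
    · have h0 : ContMDiffAt 𝓘(ℝ, E) 𝓘(ℝ, E).tangent ∞
          (fun y => (⟨y, 0⟩ : TangentBundle 𝓘(ℝ, E) M)) x :=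
        Bundle.contMDiff_zeroSection ℝ (TangentSpace 𝓘(ℝ, E) : M → Type _) x
      refine h0.congr_of_eventuallyEq ?_
      filter_upwards [(isClosed_tsupport φ).isOpen_compl.mem_nhds hx] with y hy
      rw [image_eq_zero_of_notMem_tsupport hy, zero_smul]
  · filter_upwards [φ.eventuallyEq_one] with x hx
    rw [hx, Pi.one_apply, one_smul]

lemma exists_smoothField_symmL (u : M) (w : E) :
    ∃ Y : VField E M, SmoothField Y ∧ ∀ᶠ x in 𝓝 u,
      Y x = (trivializationAt E (TangentSpace 𝓘(ℝ, E) : M → Type _) u).symmL ℝ x w := by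
  refine SmoothFieldNear.exists_smoothField ?_
  set t := trivializationAt E (TangentSpace 𝓘(ℝ, E) : M → Type _) u
  have ht := t.open_baseSet.mem_nhds (FiberBundle.mem_baseSet_trivializationAt' u)
  filter_upwards [ht] with x hx
  rw [t.contMDiffAt_section_iff (IB := 𝓘(ℝ, E)) (n := ∞) hx]
  refine (contMDiffAt_const (c := w)).congr_of_eventuallyEq ?_
  filter_upwards [t.open_baseSet.mem_nhds hx] with y hy
  rw [Trivialization.symmL_apply _ hy, Trivialization.apply_mk_symm _ hy]

lemma exists_smoothField_eq {u : M} (v : TangentSpace 𝓘(ℝ, E) u) :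
    ∃ Y : VField E M, SmoothField Y ∧ Y u = v := by
  obtain ⟨Y, hY, hYe⟩ := exists_smoothField_symmL u
    (trivializationAt E (TangentSpace 𝓘(ℝ, E) : M → Type _) u ⟨u, v⟩).2
  have hu := FiberBundle.mem_baseSet_trivializationAt' (F := E)
    (E := (TangentSpace 𝓘(ℝ, E) : M → Type _)) u
  refine ⟨Y, hY, ?_⟩
  rw [hYe.self_of_nhds, Trivialization.symmL_apply _ hu]
  exact Trivialization.symm_apply_apply_mk _ hu _

end Extension

section Along

variable [FiniteDimensional ℝ F] [T2Space N] [IsManifold 𝓘(ℝ, F) ∞ N] {f : M → N} {u : M}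

/-- In the trivialization around f u, V is a finite sum of a_i • (Y_i ∘ f), with Y_i a global field
extending the i-th constant-component frame field and a_i the i-th component of V. An identity that
is local and stable under sums and function multiples therefore only has to be checked on
restrictions of ambient fields. -/
theorem SmoothAlongNear.induction (hf : ContMDiff 𝓘(ℝ, E) 𝓘(ℝ, F) ∞ f)
    {P : (Π u : M, TangentSpace 𝓘(ℝ, F) (f u)) → Prop}
    (hcomp : ∀ Y : VField F N, SmoothField Y → P (fun x => Y (f x)))
    (hadd : ∀ V W : Π u : M, TangentSpace 𝓘(ℝ, F) (f u), SmoothAlongNear (E := E) f V u →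
      SmoothAlongNear (E := E) f W u → P V → P W → P (V + W))
    (hsmul : ∀ (a : M → ℝ) (V : Π u : M, TangentSpace 𝓘(ℝ, F) (f u)),
      SmoothFunNear (E := E) a u → SmoothAlongNear (E := E) f V u → P V → P (a • V))
    (hcongr : ∀ V W : Π u : M, TangentSpace 𝓘(ℝ, F) (f u), SmoothAlongNear (E := E) f V u →
      (∀ᶠ x in 𝓝 u, V x = W x) → P V → P W)
    {V : Π u : M, TangentSpace 𝓘(ℝ, F) (f u)} (hV : SmoothAlongNear (E := E) f V u) : P V := by
  set t := trivializationAt F (TangentSpace 𝓘(ℝ, F) : N → Type _) (f u) with ht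
  let b := Module.finBasis ℝ F
  choose Y hY hYe using fun i => exists_smoothField_symmL (M := N) (f u) (b i)
  let a : Fin (Module.finrank ℝ F) → M → ℝ := fun i x => b.coord i (t ⟨f x, V x⟩).2
  have ha : ∀ i, SmoothFunNear (E := E) (a i) u := by
    intro i
    filter_upwards [hV, eventually_mem_baseSet (F := F) hf.continuous.continuousAt] with x hx hxt
    have h := ((t.contMDiffAt_iff (IB := 𝓘(ℝ, F)) (n := ∞) (by
      rw [t.mem_source]; exact hxt)).1 hx).2
    exact ((b.coord i).toContinuousLinearMap.contMDiff.contMDiffAt (n := ∞)).comp x h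
  have key : ∀ s : Finset (Fin (Module.finrank ℝ F)),
      SmoothAlongNear (E := E) f (∑ i ∈ s, a i • fun x => Y i (f x)) u ∧
        P (∑ i ∈ s, a i • fun x => Y i (f x)) := by
    intro s
    classical
    induction s using Finset.induction_on with
    | empty =>
      have h0 : SmoothField (0 : VField F N) :=
        Bundle.contMDiff_zeroSection ℝ (TangentSpace 𝓘(ℝ, F) : N → Type _)
      exact ⟨h0.comp_along hf u, hcomp 0 h0⟩
    | insert i s his ih =>
      rw [Finset.sum_insert his]
      have h1 := (hY i).comp_along hf u
      have h2 := h1.smul (ha i)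
      exact ⟨h2.add ih.1, hadd _ _ h2 ih.1 (hsmul _ _ (ha i) h1 (hcomp _ (hY i))) ih.2⟩
  refine hcongr _ _ (key Finset.univ).1 ?_ (key Finset.univ).2
  have hYe' : ∀ᶠ x in 𝓝 u, ∀ i, Y i (f x) = t.symmL ℝ (f x) (b i) :=
    hf.continuous.continuousAt.eventually (eventually_all.2 hYe)
  filter_upwards [hYe', eventually_mem_baseSet (F := F) hf.continuous.continuousAt] with x hx hxt
  rw [Finset.sum_apply]
  calc ∑ i, (a i • fun x => Y i (f x)) x = ∑ i, a i x • t.symmL ℝ (f x) (b i) := by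
        refine Finset.sum_congr rfl fun i _ => ?_
        rw [← hx i]; rfl
    _ = t.symmL ℝ (f x) (∑ i, b.coord i (t ⟨f x, V x⟩).2 • b i) := by
        rw [map_sum]; simp only [map_smul]; rfl
    _ = V x := by
        simp only [Module.Basis.coord_apply]
        rw [b.sum_repr, Trivialization.symmL_apply _ hxt]
        exact Trivialization.symm_apply_apply_mk _ hxt _

end Along

end

/-! ### Agreement of `covAlong` with the connection on restricted ambient fields; smoothness of
derivatives. -/

section

variable {E : Type*} [NormedAddCommGroup E] [NormedSpace ℝ E]
  {M : Type*} [TopologicalSpace M] [ChartedSpace E M]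
  {F : Type*} [NormedAddCommGroup F] [NormedSpace ℝ F]
  {N : Type*} [TopologicalSpace N] [ChartedSpace F N]
  {G : Type*} [NormedAddCommGroup G] [NormedSpace ℝ G]

lemma mvfderiv_comp_map_apply {f : M → N} {h : N → G} {u : M}
    (hh : MDifferentiableAt 𝓘(ℝ, F) 𝓘(ℝ, G) h (f u)) (hf : MDifferentiableAt 𝓘(ℝ, E) 𝓘(ℝ, F) f u)
    (x : TangentSpace 𝓘(ℝ, E) u) :
    mvfderiv 𝓘(ℝ, E) (fun y => h (f y)) u x =
      mvfderiv 𝓘(ℝ, F) h (f u) (mfderiv 𝓘(ℝ, E) 𝓘(ℝ, F) f u x) :=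
  mfderiv_comp_apply u hh hf x

lemma mvfderiv_fun_const_near {a : M → G} {c : G} {u : M} (h : ∀ᶠ x in 𝓝 u, a x = c) :
    mvfderiv 𝓘(ℝ, E) a u = 0 := by
  rw [mvfderiv_congr_of_eventuallyEq (b := fun _ => c) h, mvfderiv_const]

section CovAlong

variable [IsManifold 𝓘(ℝ, F) ∞ N] {f : M → N} {u : M} {D : Connection F N}

lemma MDifferentiableAt.alongComp_id {Y : VField F N} {p : N}
    (hY : MDifferentiableAt 𝓘(ℝ, F) 𝓘(ℝ, F).tangent
      (fun q => (⟨q, Y q⟩ : TangentBundle 𝓘(ℝ, F) N)) p) :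
    MDifferentiableAt 𝓘(ℝ, F) 𝓘(ℝ, F) (alongComp id Y p) p :=
  ((mdifferentiableAt_totalSpace 𝓘(ℝ, F) _).1 hY).2

/-- The coordinate expression obeys the same Leibniz rule as D, so the derivatives of the
coefficient cancel in the difference. -/
lemma connection_sub_alongComp_tensorial (D : Connection F N) (p : N) :
    TensorialAt 𝓘(ℝ, F) F (fun Y : VField F N => D Y p -
      (((trivializationAt F (TangentSpace 𝓘(ℝ, F) : N → Type _) p).symmL ℝ p).comp
        (mvfderiv 𝓘(ℝ, F) (alongComp id Y p) p) + D (FiberBundle.extend F (Y p)) p)) p where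
  add {Y Z} hY hZ := by
    rw [mvfderiv_congr_of_eventuallyEq (alongComp_add (f := id) (V := Y) (W := Z) continuousAt_id),
      mvfderiv_add (MDifferentiableAt.alongComp_id hY) (MDifferentiableAt.alongComp_id hZ),
      Pi.add_apply, connection_extend_add,
      D.isCovariantDerivativeOn.add (s := Set.univ) hY hZ trivial, ContinuousLinearMap.comp_add]
    abel
  smul {a Y} ha hY := by
    rw [mvfderiv_congr_of_eventuallyEq (alongComp_smul (f := id) (V := Y) continuousAt_id),
      mvfderiv_smul ha (MDifferentiableAt.alongComp_id hY),
      Pi.smul_apply', connection_extend_smul,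
      D.isCovariantDerivativeOn.leibniz (s := Set.univ) hY ha trivial]
    have hp := FiberBundle.mem_baseSet_trivializationAt' (F := F)
      (E := (TangentSpace 𝓘(ℝ, F) : N → Type _)) p
    have : (trivializationAt F (TangentSpace 𝓘(ℝ, F) : N → Type _) p).symmL ℝ p
        (alongComp id Y p p) = Y p := by
      rw [Trivialization.symmL_apply _ hp]
      exact Trivialization.symm_apply_apply_mk _ hp _
    ext v
    simp only [sub_apply, add_apply, smul_apply, ContinuousLinearMap.comp_apply, map_add, map_smul,
      ContinuousLinearMap.smulRight_apply, this, smul_add, smul_sub]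
    abel

variable [FiniteDimensional ℝ F]

/-- By tensoriality the difference depends only on Y p, so it can be evaluated on the extension of Y
p. That field has locally constant components, and there the difference is zero. -/
lemma connection_eq_alongComp {Y : VField F N} {p : N}
    (hY : MDifferentiableAt 𝓘(ℝ, F) 𝓘(ℝ, F).tangent
      (fun q => (⟨q, Y q⟩ : TangentBundle 𝓘(ℝ, F) N)) p) :
    D Y p = ((trivializationAt F (TangentSpace 𝓘(ℝ, F) : N → Type _) p).symmL ℝ p).comp
        (mvfderiv 𝓘(ℝ, F) (alongComp id Y p) p) + D (FiberBundle.extend F (Y p)) p := by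
  have h := (connection_sub_alongComp_tensorial D p).pointwise hY (mdifferentiableAt_extend (Y p))
    (by simp)
  rw [← sub_eq_zero, h, mvfderiv_fun_const_near (c := alongComp id Y p p), FiberBundle.extend_apply_self]
  · simp
  · filter_upwards [eventually_mem_baseSet (F := F) (f := (id : N → N)) continuousAt_id] with q hq
    have hq' : q ∈ (trivializationAt F (TangentSpace 𝓘(ℝ, F) : N → Type _) p).baseSet := hq
    have h1 := congrArg Prod.snd (Trivialization.apply_mk_symm _ hq'
      (trivializationAt F (TangentSpace 𝓘(ℝ, F) : N → Type _) p ⟨p, Y p⟩).2)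
    exact h1

lemma covAlong_comp {Y : VField F N} (hY : MDifferentiableAt 𝓘(ℝ, F) 𝓘(ℝ, F).tangent
      (fun q => (⟨q, Y q⟩ : TangentBundle 𝓘(ℝ, F) N)) (f u))
    (hf : MDifferentiableAt 𝓘(ℝ, E) 𝓘(ℝ, F) f u) (x : TangentSpace 𝓘(ℝ, E) u) :
    covAlong D f (fun y => Y (f y)) u x = D Y (f u) (mfderiv 𝓘(ℝ, E) 𝓘(ℝ, F) f u x) := by
  rw [covAlong_eq, connection_eq_alongComp hY, add_apply, ContinuousLinearMap.comp_apply,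
    ← mvfderiv_comp_map_apply (MDifferentiableAt.alongComp_id hY) hf]
  rfl

end CovAlong

section Smoothness

lemma SmoothFunNear.mvfderiv_apply [IsManifold 𝓘(ℝ, E) ∞ M] {a : M → G} {u : M} {X : VField E M}
    (ha : SmoothFunNear (E := E) a u) (hX : SmoothFieldNear X u) :
    SmoothFunNear (E := E) (fun x => mvfderiv 𝓘(ℝ, E) a x (X x)) u := by
  filter_upwards [ha, hX] with x hax hXx
  have h1 := hax.mfderiv_const (m := ∞) (by simp)
  have h2 := ContMDiffAt.clm_apply_of_inCoordinates h1 hXx hax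
  exact (contMDiff_snd_tangentBundle_modelSpace G 𝓘(ℝ, G)).contMDiffAt.comp x h2

lemma SmoothFieldNear.mfderiv_apply [IsManifold 𝓘(ℝ, E) ∞ M] [IsManifold 𝓘(ℝ, F) ∞ N]
    {f : M → N} {u : M} {X : VField E M} (hX : SmoothFieldNear X u)
    (hf : ContMDiff 𝓘(ℝ, E) 𝓘(ℝ, F) ∞ f) :
    SmoothAlongNear (E := E) f (fun x => mfderiv 𝓘(ℝ, E) 𝓘(ℝ, F) f x (X x)) u := by
  filter_upwards [hX] with x hXx
  exact ContMDiffAt.clm_apply_of_inCoordinates (hf.contMDiffAt.mfderiv_const (m := ∞) (by simp)) hXx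
    hf.contMDiffAt

variable [IsManifold 𝓘(ℝ, F) ∞ N] {f : M → N} {u : M}

lemma SmoothAlongNear.metric (g : SemiRiemannianMetric F N)
    {V W : Π u : M, TangentSpace 𝓘(ℝ, F) (f u)}
    (hV : SmoothAlongNear (E := E) f V u) (hW : SmoothAlongNear (E := E) f W u) :
    SmoothFunNear (E := E) (fun x => g.val (f x) (V x) (W x)) u := by
  filter_upwards [hV, hW] with x hVx hWx
  have hf := (contMDiffAt_along_iff.1 hVx).1
  have hg := g.contMDiff.contMDiffAt.comp x hf
  have h := ContMDiffAt.clm_bundle_apply₂ (F₁ := F) (F₂ := F) (F₃ := ℝ)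
    (E₃ := fun _ : N => ℝ) hg hVx hWx
  exact (contMDiffAt_totalSpace.1 h).2

/-- On restrictions of ambient fields this is smoothness of the connection; the Leibniz rule
propagates it to all smooth fields along f. -/
lemma SmoothAlongNear.covAlong_apply [FiniteDimensional ℝ F] [T2Space N] [IsManifold 𝓘(ℝ, E) ∞ M]
    {D : Connection F N}
    (hD : CovariantDerivative.ContMDiffCovariantDerivative D ∞)
    (hf : ContMDiff 𝓘(ℝ, E) 𝓘(ℝ, F) ∞ f) {X : VField E M} (hX : SmoothFieldNear X u)
    {V : Π u : M, TangentSpace 𝓘(ℝ, F) (f u)} (hV : SmoothAlongNear (E := E) f V u) :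
    SmoothAlongNear (E := E) f (fun x => covAlong D f V x (X x)) u := by
  refine SmoothAlongNear.induction (u := u) hf
    (P := fun V => SmoothAlongNear (E := E) f (fun x => covAlong D f V x (X x)) u) ?_ ?_ ?_ ?_ hV
  · intro Y hY
    have h1 := (hD.contMDiff.contMDiff (σ := Y) (by simpa using! hY.contMDiffOn))
    have h2 : SmoothAlongNear (E := E) f
        (fun x => D Y (f x) (mfderiv 𝓘(ℝ, E) 𝓘(ℝ, F) f x (X x))) u := by
      filter_upwards [hX.mfderiv_apply hf] with x hx
      have h3 := (h1.contMDiffAt (x := f x) univ_mem).comp x hf.contMDiffAt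
      exact ContMDiffAt.clm_bundle_apply h3 hx
    refine h2.congr (Eventually.of_forall fun x => ?_)
    rw [covAlong_comp ((hY (f x)).mdifferentiableAt (by simp))
      (hf.contMDiffAt.mdifferentiableAt (by simp))]
  · intro V W hV hW hPV hPW
    refine (hPV.add hPW).congr ?_
    filter_upwards [hV.eventually, hW.eventually] with x hx hx'
    rw [covAlong_add hx hx', Pi.add_apply]
  · intro a V ha hV hPV
    refine ((hV.smul (ha.mvfderiv_apply hX)).add (hPV.smul ha)).congr ?_
    filter_upwards [hV.eventually, ha.eventually] with x hx hx'
    rw [covAlong_smul hx' hx, Pi.add_apply, Pi.smul_apply', Pi.smul_apply']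
  · intro V W hV hVW hPV
    refine hPV.congr ?_
    filter_upwards [eventually_eventually_nhds.2 hVW] with x hx
    exact covAlong_congr hx _

end Smoothness

end

/-! ### The Lie bracket as the commutator of derivations. -/

section

variable {E : Type*} [NormedAddCommGroup E] [NormedSpace ℝ E]
  {M : Type*} [TopologicalSpace M] [ChartedSpace E M]
  {F : Type*} [NormedAddCommGroup F] [NormedSpace ℝ F]
  {N : Type*} [TopologicalSpace N] [ChartedSpace F N]
  {G : Type*} [NormedAddCommGroup G] [NormedSpace ℝ G]

section LieBracket

variable [IsManifold 𝓘(ℝ, E) ∞ M]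

/-- The vector field `X` read in the chart at `u`. -/
def chartField (X : VField E M) (u : M) : E → E :=
  VectorField.mpullbackWithin 𝓘(ℝ, E) 𝓘(ℝ, E) (extChartAt 𝓘(ℝ, E) u).symm X (Set.range 𝓘(ℝ, E))

lemma mfderivWithin_symm_chartField (X : VField E M) (u : M) {y : E}
    (hy : y ∈ (extChartAt 𝓘(ℝ, E) u).target) :
    mfderivWithin 𝓘(ℝ, E) 𝓘(ℝ, E) (extChartAt 𝓘(ℝ, E) u).symm (Set.range 𝓘(ℝ, E)) y
      (chartField (E := E) X u y) = X ((extChartAt 𝓘(ℝ, E) u).symm y) := by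
  obtain ⟨e, he⟩ := isInvertible_mfderivWithin_extChartAt_symm (I := 𝓘(ℝ, E)) hy
  have h : chartField X u y = e.symm (X ((extChartAt 𝓘(ℝ, E) u).symm y)) := by
    change (mfderivWithin 𝓘(ℝ, E) 𝓘(ℝ, E) (extChartAt 𝓘(ℝ, E) u).symm (Set.range 𝓘(ℝ, E)) y).inverse
      (X ((extChartAt 𝓘(ℝ, E) u).symm y)) = _
    rw [← he, ContinuousLinearMap.inverse_equiv]
    rfl
  rw [h, ← he]
  exact e.apply_symm_apply _

/-- Chain rule for the inverse chart: it turns derivatives on M into Fréchet derivatives on E, where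
second derivatives are symmetric. -/
lemma mvfderiv_chartField {a : M → G} (X : VField E M) (u : M) {y : E}
    (hy : y ∈ (extChartAt 𝓘(ℝ, E) u).target)
    (ha : MDifferentiableAt 𝓘(ℝ, E) 𝓘(ℝ, G) a ((extChartAt 𝓘(ℝ, E) u).symm y)) :
    mvfderiv 𝓘(ℝ, E) a ((extChartAt 𝓘(ℝ, E) u).symm y) (X ((extChartAt 𝓘(ℝ, E) u).symm y)) =
      fderiv ℝ (a ∘ (extChartAt 𝓘(ℝ, E) u).symm) y (chartField (E := E) X u y) := by
  have h1 := mdifferentiableWithinAt_extChartAt_symm (I := 𝓘(ℝ, E)) hy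
  have h2 := mfderiv_comp_mfderivWithin y ha h1 (by simpa using uniqueMDiffWithinAt_univ 𝓘(ℝ, E))
  rw [← mfderivWithin_symm_chartField X u hy]
  have h3 := congrArg (fun L : E →L[ℝ] G => L (chartField X u y)) h2
  refine Eq.trans (Eq.symm h3) ?_
  simp

lemma differentiableAt_chartField [CompleteSpace E] {X : VField E M} {u : M}
    (hX : SmoothFieldNear X u) :
    DifferentiableAt ℝ (chartField X u) (extChartAt 𝓘(ℝ, E) u u) := by
  have := (mdifferentiableWithinAt_univ.2 hX.mdiff).differentiableWithinAt_mpullbackWithin_vectorField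
  rw [← differentiableWithinAt_univ]
  convert! this using 1
  simp

lemma chartField_mlieBracket (X Y : VField E M) (u : M) :
    chartField (VectorField.mlieBracket 𝓘(ℝ, E) X Y) u (extChartAt 𝓘(ℝ, E) u u) =
      VectorField.lieBracket ℝ (chartField X u) (chartField Y u) (extChartAt 𝓘(ℝ, E) u u) := by
  set φ := extChartAt 𝓘(ℝ, E) u with hφ
  set Z := VectorField.mlieBracket 𝓘(ℝ, E) X Y
  have hu : φ.symm (φ u) = u := by simp [hφ]
  have hut : φ u ∈ φ.target := mem_extChartAt_target u
  have hmd : MDifferentiableAt 𝓘(ℝ, E) 𝓘(ℝ, E) φ u :=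
    mdifferentiableAt_extChartAt (mem_chart_source E u)
  -- Taking the chart φ itself as the function identifies the chart expression of Z at φ u with dφ(Z
  -- u), since φ ∘ φ.symm is the identity near φ u.
  have h1 := mvfderiv_chartField (a := φ) Z u hut (by rw [← hφ, hu]; exact hmd)
  rw [← hφ, hu] at h1
  have h2 : φ ∘ φ.symm =ᶠ[𝓝 (φ u)] id := by
    filter_upwards [extChartAt_target_mem_nhds (I := 𝓘(ℝ, E)) u] with y hy
    exact φ.right_inv hy
  rw [h2.fderiv_eq, fderiv_id] at h1
  refine Eq.trans (Eq.symm h1) ?_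
  obtain ⟨e, he⟩ := isInvertible_mfderiv_extChartAt (I := 𝓘(ℝ, E)) (mem_extChartAt_source u)
  obtain ⟨w, hw⟩ : ∃ w : E,
    w = VectorField.lieBracket ℝ (chartField X u) (chartField Y u) (φ u) := ⟨_, rfl⟩
  have h3 : Z u = e.symm w := by
    have h4 := congrFun (VectorField.mlieBracketWithin_def (I := 𝓘(ℝ, E)) (V := X) (W := Y)
      (s := Set.univ)) u
    refine Eq.trans h4 ?_
    change (mfderiv 𝓘(ℝ, E) 𝓘(ℝ, E) (extChartAt 𝓘(ℝ, E) u) u).inverse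
      (VectorField.lieBracketWithin (E := E) ℝ (chartField (E := E) X u) (chartField (E := E) Y u)
        ((extChartAt 𝓘(ℝ, E) u).symm ⁻¹' Set.univ ∩ Set.range 𝓘(ℝ, E)) (φ u)) = _
    rw [← he, ContinuousLinearMap.inverse_equiv]
    refine congrArg e.symm ?_
    rw [hw, ← VectorField.lieBracketWithin_univ]
    congr 1
    simp
    rfl
  rw [h3, ← hw]
  exact (congrArg (fun L : E →L[ℝ] E => L (e.symm w)) he.symm).trans (e.apply_symm_apply w)

/-- In a chart, XYa - YXa consists of the derivative of a along the Lie bracket plus two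
second-derivative terms, which cancel by symmetry. -/
theorem mvfderiv_mlieBracket [CompleteSpace E] {a : M → G} {X Y : VField E M} {u : M}
    (ha : SmoothFunNear (E := E) a u) (hX : SmoothFieldNear X u) (hY : SmoothFieldNear Y u) :
    mvfderiv 𝓘(ℝ, E) a u (VectorField.mlieBracket 𝓘(ℝ, E) X Y u) =
      mvfderiv 𝓘(ℝ, E) (fun x => mvfderiv 𝓘(ℝ, E) a x (Y x)) u (X u) -
      mvfderiv 𝓘(ℝ, E) (fun x => mvfderiv 𝓘(ℝ, E) a x (X x)) u (Y u) := by
  set φ := extChartAt 𝓘(ℝ, E) u with hφ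
  have hu : φ.symm (φ u) = u := by simp [hφ]
  have hut : φ u ∈ φ.target := mem_extChartAt_target u
  have h1 : ∀ {b : M → G} (Z : VField E M),
      MDifferentiableAt 𝓘(ℝ, E) 𝓘(ℝ, G) b u → mvfderiv 𝓘(ℝ, E) b u (Z u) =
        fderiv ℝ (b ∘ φ.symm) (φ u) (chartField Z u (φ u)) := by
    intro b Z hb
    have := mvfderiv_chartField (a := b) Z u hut (by rw [← hφ, hu]; exact hb)
    rwa [← hφ, hu] at this
  have hφc : Tendsto φ.symm (𝓝 (φ u)) (𝓝 u) := by
    have := continuousAt_extChartAt_symm (I := 𝓘(ℝ, E)) u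
    rw [ContinuousAt, ← hφ, hu] at this
    exact this
  have hnear : ∀ᶠ y in 𝓝 (φ u), ContMDiffAt 𝓘(ℝ, E) 𝓘(ℝ, G) ∞ a (φ.symm y) :=
    hφc.eventually ha
  have htar : ∀ᶠ y in 𝓝 (φ u), y ∈ φ.target := extChartAt_target_mem_nhds u
  have h2 : ∀ Z : VField E M, (fun x => mvfderiv 𝓘(ℝ, E) a x (Z x)) ∘ φ.symm =ᶠ[𝓝 (φ u)]
      fun y => fderiv ℝ (a ∘ φ.symm) y (chartField Z u y) := by
    intro Z
    filter_upwards [hnear, htar] with y hy hyt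
    exact mvfderiv_chartField Z u hyt (hy.mdifferentiableAt (by simp))
  have hac : ContDiffAt ℝ ∞ (a ∘ φ.symm) (φ u) := by
    have h3 : ContMDiffAt 𝓘(ℝ, E) 𝓘(ℝ, E) ∞ φ.symm (φ u) :=
      (contMDiffOn_extChartAt_symm u).contMDiffAt (extChartAt_target_mem_nhds u)
    exact (ContMDiffAt.comp (φ u) (by rw [hu]; exact ha.at) h3).contDiffAt
  have hd : DifferentiableAt ℝ (fderiv ℝ (a ∘ φ.symm)) (φ u) :=
    (hac.fderiv_right (m := 1) (by norm_cast)).differentiableAt (by simp)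
  have hsymm := hac.isSymmSndFDerivAt (by simp; norm_cast)
  have hX' := differentiableAt_chartField hX
  have hY' := differentiableAt_chartField hY
  rw [h1 _ ha.mdiff, chartField_mlieBracket, h1 X (ha.mvfderiv_apply hY).mdiff,
    h1 Y (ha.mvfderiv_apply hX).mdiff, (h2 X).fderiv_eq, (h2 Y).fderiv_eq,
    fderiv_clm_apply hd hX', fderiv_clm_apply hd hY', VectorField.lieBracket_eq]
  simp only [map_sub, add_apply, ContinuousLinearMap.comp_apply, ContinuousLinearMap.flip_apply]
  rw [hsymm.eq]
  abel

end LieBracket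

end

/-! ### Algebraic curvature tensors are determined by their sectional curvatures. -/

section

section Polarization

variable {W : Type*} [AddCommGroup W] [Module ℝ W]

/-- A polynomial function of degree four vanishing off the zero set of a nonzero polynomial function
vanishes at zero. -/
lemma quartic_coeff_zero_eq_zero {a b : Fin 5 → ℝ} (hb : b 4 ≠ 0)
    (h : ∀ t : ℝ, (∑ i, b i * t ^ (i : ℕ)) ≠ 0 → (∑ i, a i * t ^ (i : ℕ)) = 0) : a 0 = 0 := by
  classical
  let p : (Fin 5 → ℝ) → Polynomial ℝ := fun c => ∑ i, Polynomial.C (c i) * Polynomial.X ^ (i : ℕ)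
  have he : ∀ c t, (p c).eval t = ∑ i, c i * t ^ (i : ℕ) := by
    intro c t
    simp [p, Polynomial.eval_finsetSum]
  -- The product vanishes at every real number, so it is the zero polynomial; the ring of
  -- polynomials has no zero divisors and p b is nonzero.
  have hprod : p a * p b = 0 := by
    refine Polynomial.funext fun t => ?_
    rw [Polynomial.eval_mul, he, he, Polynomial.eval_zero]
    by_cases hq : (∑ i, b i * t ^ (i : ℕ)) = 0
    · rw [hq, mul_zero]
    · rw [h t hq, zero_mul]
  have hpb : p b ≠ 0 := by
    intro h0
    have := congrArg (fun q => q.coeff 4) h0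
    simp [p, Fin.sum_univ_five] at this
    exact hb this
  have hpa := (mul_eq_zero.1 hprod).resolve_right hpb
  have := he a 0
  rw [hpa] at this
  simpa [Fin.sum_univ_five] using this.symm

variable {T : W → W → W → W → ℝ} {B : W → W → ℝ}

/-- Degenerate planes are limits of nondegenerate ones: moving x and y along a nondegenerate pair
(v, w) makes both the sectional expression and the Gram determinant quartic in t, and the second has
nonzero leading coefficient. -/
lemma sectional_eq_zero
    (add₁ : ∀ x x' y z w, T (x + x') y z w = T x y z w + T x' y z w)
    (smul₁ : ∀ (t : ℝ) x y z w, T (t • x) y z w = t * T x y z w)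
    (skew₁₂ : ∀ x y z w, T x y z w = -T y x z w)
    (add₃ : ∀ x y z z' w, T x y (z + z') w = T x y z w + T x y z' w)
    (smul₃ : ∀ (t : ℝ) x y z w, T x y (t • z) w = t * T x y z w)
    (skew₃₄ : ∀ x y z w, T x y z w = -T x y w z)
    (Badd : ∀ x x' y, B (x + x') y = B x y + B x' y)
    (Bsmul : ∀ (t : ℝ) x y, B (t • x) y = t * B x y)
    (Bsymm : ∀ x y, B x y = B y x)
    (hT : ∀ x y, B x x * B y y - B x y ^ 2 ≠ 0 → T x y y x = 0)
    (hB : ∃ x y, B x x * B y y - B x y ^ 2 ≠ 0) (x y : W) : T x y y x = 0 := by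
  obtain ⟨v, w, hvw⟩ := hB
  have add₂ : ∀ x y y' z w, T x (y + y') z w = T x y z w + T x y' z w := by
    intro x y y' z w; rw [skew₁₂, add₁, skew₁₂ y, skew₁₂ y']; ring
  have smul₂ : ∀ (t : ℝ) x y z w, T x (t • y) z w = t * T x y z w := by
    intro t x y z w; rw [skew₁₂, smul₁, skew₁₂ y]; ring
  have add₄ : ∀ x y z w w', T x y z (w + w') = T x y z w + T x y z w' := by
    intro x y z w w'; rw [skew₃₄, add₃, skew₃₄ _ _ w, skew₃₄ _ _ w']; ring
  have smul₄ : ∀ (t : ℝ) x y z w, T x y z (t • w) = t * T x y z w := by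
    intro t x y z w; rw [skew₃₄, smul₃, skew₃₄ _ _ w]; ring
  have Badd' : ∀ x y y', B x (y + y') = B x y + B x y' := by
    intro x y y'; rw [Bsymm, Badd, Bsymm y, Bsymm y']
  have Bsmul' : ∀ (t : ℝ) x y, B x (t • y) = t * B x y := by
    intro t x y; rw [Bsymm, Bsmul, Bsymm y]
  -- The entries are the coefficients of 1, t, ..., t⁴ in T evaluated at (x + tv, y + tw, y + tw, x
  -- + tv), and in the Gram determinant of x + tv and y + tw.
  have := quartic_coeff_zero_eq_zero
    (a := ![T x y y x,
      T v y y x + T x w y x + T x y w x + T x y y v,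
      T v w y x + T v y w x + T v y y v + T x w w x + T x w y v + T x y w v,
      T v w w x + T v w y v + T v y w v + T x w w v,
      T v w w v])
    (b := ![B x x * B y y - B x y ^ 2,
      2 * B x v * B y y + 2 * B x x * B y w - 2 * B x y * (B x w + B v y),
      B v v * B y y + 4 * B x v * B y w + B x x * B w w - (B x w + B v y) ^ 2
        - 2 * B x y * B v w,
      2 * B v v * B y w + 2 * B x v * B w w - 2 * B v w * (B x w + B v y),
      B v v * B w w - B v w ^ 2]) (by simpa using hvw) (by
      intro t ht
      have h1 := hT (x + t • v) (y + t • w)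
      simp only [add₁, add₂, add₃, add₄, smul₁, smul₂, smul₃, smul₄, Badd, Badd', Bsmul,
        Bsmul'] at h1
      rw [Bsymm v x, Bsymm w y] at h1
      simp only [Fin.sum_univ_five] at ht ⊢
      simp at ht ⊢
      have h2 := h1 (by intro h0; apply ht; linear_combination h0)
      linear_combination h2)
  simpa using this

/-- Polarizing the outer and then the middle arguments makes T skew in the second and third slots as
well. Together with skewness in the first two it is then invariant under cyclic permutation of the
first three, so the Bianchi identity reads 3T = 0. -/
theorem eq_zero_of_sectional_eq_zero {W : Type*} [AddCommGroup W] {T : W → W → W → W → ℝ}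
    (add₁ : ∀ x x' y z w, T (x + x') y z w = T x y z w + T x' y z w)
    (skew₁₂ : ∀ x y z w, T x y z w = -T y x z w)
    (add₃ : ∀ x y z z' w, T x y (z + z') w = T x y z w + T x y z' w)
    (skew₃₄ : ∀ x y z w, T x y z w = -T x y w z)
    (bianchi : ∀ x y z w, T x y z w + T y z x w + T z x y w = 0)
    (hT : ∀ x y, T x y y x = 0) (x y z w : W) : T x y z w = 0 := by
  have add₂ : ∀ x y y' z w, T x (y + y') z w = T x y z w + T x y' z w := by
    intro x y y' z w; rw [skew₁₂, add₁, skew₁₂ y, skew₁₂ y']; ring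
  have add₄ : ∀ x y z w w', T x y z (w + w') = T x y z w + T x y z w' := by
    intro x y z w w'; rw [skew₃₄, add₃, skew₃₄ _ _ w, skew₃₄ _ _ w']; ring
  -- Pair symmetry follows from the four Bianchi identities obtained by cyclically rotating all four
  -- arguments.
  have pair : ∀ x y z w, T x y z w = T z w x y := by
    intro x y z w
    linarith [bianchi x y z w, bianchi y z w x, bianchi z w x y, bianchi w x y z,
      skew₁₂ x y z w, skew₁₂ y z w x, skew₁₂ z w x y, skew₁₂ w x y z, skew₁₂ x z y w,
      skew₁₂ y w x z, skew₁₂ x z w y, skew₁₂ y w z x, skew₃₄ x y z w, skew₃₄ y z x w, skew₃₄ z x y w,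
      skew₃₄ z w x y, skew₃₄ w x y z, skew₃₄ y w z x, skew₃₄ x z y w, skew₃₄ w y z x]
  have h1 : ∀ x y z, T x y y z = 0 := by
    intro x y z
    have h := hT (x + z) y
    rw [add₁, add₄, add₄, hT, hT] at h
    have h2 := pair z y y x
    rw [skew₁₂ y x, skew₃₄ x y z y] at h2
    linarith
  have h2 : ∀ x y w z, T x y w z = -T x w y z := by
    intro x y w z
    have h := h1 x (y + w) z
    rw [add₂, add₃, add₃, h1, h1] at h
    linarith
  linarith [bianchi x y z w, h2 x y z w, skew₁₂ x z y w, h2 y z x w, skew₁₂ y x z w]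

end Polarization

end

/-! ### Symmetries of the Levi-Civita curvature, and its form in constant sectional curvature. -/

section

variable {F : Type*} [NormedAddCommGroup F] [NormedSpace ℝ F]
  {N : Type*} [TopologicalSpace N] [ChartedSpace F N]

section SmoothFields

variable [IsManifold 𝓘(ℝ, F) ∞ N]

lemma SmoothField.mdiff {X : VField F N} (hX : SmoothField X) (p : N) :
    MDifferentiableAt 𝓘(ℝ, F) 𝓘(ℝ, F).tangent
      (fun q => (⟨q, X q⟩ : TangentBundle 𝓘(ℝ, F) N)) p := (hX.near p).mdiff

lemma SmoothField.add {X Y : VField F N} (hX : SmoothField X) (hY : SmoothField Y) :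
    SmoothField (X + Y) := ContMDiff.add_section hX hY

lemma SmoothField.const_smul (t : ℝ) {X : VField F N} (hX : SmoothField X) :
    SmoothField (t • X) := ContMDiff.const_smul_section (a := t) hX

lemma SmoothField.mlieBracket [CompleteSpace F] {X Y : VField F N} (hX : SmoothField X)
    (hY : SmoothField Y) : SmoothField (VectorField.mlieBracket 𝓘(ℝ, F) X Y) := by
  have : IsManifold 𝓘(ℝ, F) (minSmoothness ℝ 2) N := by
    rw [minSmoothness_of_isRCLikeNormedField]
    exact IsManifold.of_le (n := ∞) (by norm_cast)
  have : IsManifold 𝓘(ℝ, F) (((⊤ : ℕ∞) : ℕ∞ω) + 1) N := ‹IsManifold 𝓘(ℝ, F) ∞ N›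
  exact fun p => ContMDiffAt.mlieBracket_vectorField (n := ⊤) (m := ⊤) (hX p) (hY p) (by simp)

lemma SmoothField.connection {D : Connection F N}
    (hD : CovariantDerivative.ContMDiffCovariantDerivative D ∞) {X Y : VField F N}
    (hX : SmoothField X) (hY : SmoothField Y) : SmoothField (fun q => D Y q (X q)) := by
  intro p
  have h1 := (hD.contMDiff.contMDiff (σ := Y) (by simpa using! hY.contMDiffOn))
  exact ContMDiffAt.clm_bundle_apply (h1.contMDiffAt univ_mem) (hX p)

variable (F N) in
/-- The real vector space of smooth vector fields. -/
def smoothFields : Submodule ℝ (VField F N) where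
  carrier := {X | SmoothField X}
  add_mem' hX hY := hX.add hY
  zero_mem' := Bundle.contMDiff_zeroSection ℝ (TangentSpace 𝓘(ℝ, F) : N → Type _)
  smul_mem' t _ hX := hX.const_smul t

variable {D : Connection F N} {X X' Y Z Z' : VField F N}

lemma connection_add (hY : SmoothField Y) (hZ : SmoothField Z) : D (Y + Z) = D Y + D Z := by
  ext1 p
  exact D.isCovariantDerivativeOn.add (s := Set.univ) (hY.mdiff p) (hZ.mdiff p) trivial

lemma connection_const_smul (t : ℝ) (hY : SmoothField Y) : D (t • Y) = t • D Y := by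
  ext1 p
  exact D.isCovariantDerivativeOn.smul_const (s := Set.univ) t (hY.mdiff p) trivial

/-- The curvature operator of a linear connection. -/
abbrev connCurv (D : Connection F N) (X Y Z : VField F N) : VField F N :=
  curvatureOp (fun V W q => D W q (V q)) X Y Z

lemma connCurv_apply (p : N) : connCurv D X Y Z p =
    D (fun q => D Z q (Y q)) p (X p) - D (fun q => D Z q (X q)) p (Y p)
      - D Z p (VectorField.mlieBracket 𝓘(ℝ, F) X Y p) := rfl

lemma connCurv_swap : connCurv D X Y Z = -connCurv D Y X Z := by
  ext1 p
  rw [Pi.neg_apply, connCurv_apply, connCurv_apply, VectorField.mlieBracket_swap_apply, map_neg]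
  abel

lemma connCurv_add_right (hD : CovariantDerivative.ContMDiffCovariantDerivative D ∞)
    (hX : SmoothField X) (hY : SmoothField Y) (hZ : SmoothField Z) (hZ' : SmoothField Z') :
    connCurv D X Y (Z + Z') = connCurv D X Y Z + connCurv D X Y Z' := by
  ext1 p
  have h : ∀ V : VField F N, (fun q => D (Z + Z') q (V q)) =
      (fun q => D Z q (V q)) + (fun q => D Z' q (V q)) := by
    intro V; ext1 q; rw [connection_add hZ hZ']; rfl
  rw [Pi.add_apply, connCurv_apply, connCurv_apply, connCurv_apply, h, h,
    connection_add (SmoothField.connection hD hX hZ) (SmoothField.connection hD hX hZ'),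
    connection_add (SmoothField.connection hD hY hZ) (SmoothField.connection hD hY hZ'),
    connection_add hZ hZ']
  simp only [Pi.add_apply, add_apply]
  abel

lemma connCurv_smul_right (hD : CovariantDerivative.ContMDiffCovariantDerivative D ∞)
    (t : ℝ) (hX : SmoothField X) (hY : SmoothField Y) (hZ : SmoothField Z) :
    connCurv D X Y (t • Z) = t • connCurv D X Y Z := by
  ext1 p
  have h : ∀ V : VField F N, (fun q => D (t • Z) q (V q)) = t • (fun q => D Z q (V q)) := by
    intro V; ext1 q; rw [connection_const_smul t hZ]; rfl
  rw [Pi.smul_apply, connCurv_apply, connCurv_apply, h, h,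
    connection_const_smul t (SmoothField.connection hD hX hZ),
    connection_const_smul t (SmoothField.connection hD hY hZ), connection_const_smul t hZ]
  simp only [Pi.smul_apply, smul_apply, smul_sub]

variable [CompleteSpace F]

lemma connCurv_add_left (hD : CovariantDerivative.ContMDiffCovariantDerivative D ∞)
    (hX : SmoothField X) (hX' : SmoothField X') (hZ : SmoothField Z) :
    connCurv D (X + X') Y Z = connCurv D X Y Z + connCurv D X' Y Z := by
  ext1 p
  have h : (fun q => D Z q ((X + X') q)) =
      (fun q => D Z q (X q)) + (fun q => D Z q (X' q)) := by
    ext1 q; simp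
  rw [Pi.add_apply, connCurv_apply, connCurv_apply, connCurv_apply, h,
    connection_add (SmoothField.connection hD hX hZ) (SmoothField.connection hD hX' hZ),
    VectorField.mlieBracket_add_left (hX.mdiff p) (hX'.mdiff p)]
  simp only [Pi.add_apply, map_add, add_apply]
  abel

lemma connCurv_smul_left (hD : CovariantDerivative.ContMDiffCovariantDerivative D ∞)
    (t : ℝ) (hX : SmoothField X) (hZ : SmoothField Z) :
    connCurv D (t • X) Y Z = t • connCurv D X Y Z := by
  ext1 p
  have h : (fun q => D Z q ((t • X) q)) = t • (fun q => D Z q (X q)) := by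
    ext1 q; simp
  rw [Pi.smul_apply, connCurv_apply, connCurv_apply, h,
    connection_const_smul t (SmoothField.connection hD hX hZ),
    VectorField.mlieBracket_const_smul_left (hX.mdiff p)]
  simp only [Pi.smul_apply, map_smul, smul_apply, smul_sub]

end SmoothFields

section LeviCivita

variable [IsManifold 𝓘(ℝ, F) ∞ N] {g : SemiRiemannianMetric F N}
  {D : Connection F N} {X Y Z W : VField F N}

lemma SmoothField.metric (hX : SmoothField X) (hY : SmoothField Y) (p : N) :
    SmoothFunNear (E := F) (fun q => g.val q (X q) (Y q)) p :=
  SmoothAlongNear.metric (f := id) g (hX.near p) (hY.near p)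

variable [FiniteDimensional ℝ F]

lemma IsLeviCivita.torsion_free (hD : IsLeviCivita g D) {p : N} (hX : SmoothField X)
    (hY : SmoothField Y) :
    D Y p (X p) - D X p (Y p) = VectorField.mlieBracket 𝓘(ℝ, F) X Y p :=
  D.torsion_eq_zero_iff.1 hD.torsion_eq_zero (hX.mdiff p) (hY.mdiff p)

/-- Torsion-freeness gives D_X D_Y Z - D_X D_Z Y = [X,[Y,Z]] + D_{[Y,Z]} X. In the cyclic sum the
last terms cancel and the Jacobi identity remains. -/
lemma connCurv_bianchi (hD : IsLeviCivita g D) (hX : SmoothField X) (hY : SmoothField Y)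
    (hZ : SmoothField Z) :
    connCurv D X Y Z + connCurv D Y Z X + connCurv D Z X Y = 0 := by
  ext1 p
  have key : ∀ {X Y Z : VField F N}, SmoothField X → SmoothField Y → SmoothField Z →
      D (fun q => D Z q (Y q)) p (X p) - D (fun q => D Y q (Z q)) p (X p) =
        VectorField.mlieBracket 𝓘(ℝ, F) X (VectorField.mlieBracket 𝓘(ℝ, F) Y Z) p +
          D X p (VectorField.mlieBracket 𝓘(ℝ, F) Y Z p) := by
    intro X Y Z hX hY hZ
    have h1 : (fun q => D Z q (Y q)) =
        (fun q => D Y q (Z q)) + VectorField.mlieBracket 𝓘(ℝ, F) Y Z := by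
      ext1 q
      rw [Pi.add_apply, ← hD.torsion_free hY hZ]; abel
    rw [h1, connection_add (SmoothField.connection hD.smooth hZ hY) (hY.mlieBracket hZ),
      ← hD.torsion_free hX (hY.mlieBracket hZ)]
    simp only [Pi.add_apply, add_apply]
    abel
  have : IsManifold 𝓘(ℝ, F) (minSmoothness ℝ 3) N := by
    rw [minSmoothness_of_isRCLikeNormedField]
    exact IsManifold.of_le (n := ∞) (by norm_cast)
  have hJ := VectorField.leibniz_identity_mlieBracket_apply (I := 𝓘(ℝ, F)) (x := p)
    ((hX p).of_le (by simp; norm_cast)) ((hY p).of_le (by simp; norm_cast))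
    ((hZ p).of_le (by simp; norm_cast))
  have h1 := key hX hY hZ
  have h2 := key hY hZ hX
  have h3 := key hZ hX hY
  rw [VectorField.mlieBracket_swap_apply (V := VectorField.mlieBracket 𝓘(ℝ, F) X Y)] at hJ
  have h4 : VectorField.mlieBracket 𝓘(ℝ, F) Y (VectorField.mlieBracket 𝓘(ℝ, F) X Z) p =
      -VectorField.mlieBracket 𝓘(ℝ, F) Y (VectorField.mlieBracket 𝓘(ℝ, F) Z X) p := by
    have h5 : VectorField.mlieBracket 𝓘(ℝ, F) X Z =
      (-1 : ℝ) • VectorField.mlieBracket 𝓘(ℝ, F) Z X := by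
      rw [VectorField.mlieBracket_swap, neg_one_smul]
    rw [h5, VectorField.mlieBracket_const_smul_right ((hZ.mlieBracket hX).mdiff p), neg_one_smul]
  rw [h4] at hJ
  simp only [Pi.add_apply, Pi.zero_apply, connCurv_apply]
  linear_combination (norm := module) h1 + h2 + h3 + hJ

/-- Apply [X,Y] = XY - YX to the function g(Z,Z): the cross terms g(D_X Z, D_Y Z) are symmetric and
drop out, leaving 2 g(R(X,Y)Z, Z) = 0. -/
lemma connCurv_metric_skew_self (hD : IsLeviCivita g D) (hX : SmoothField X) (hY : SmoothField Y)
    (hZ : SmoothField Z) (p : N) : g.val p (connCurv D X Y Z p) (Z p) = 0 := by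
  have hm : ∀ {V W : VField F N}, SmoothField V → SmoothField W → ∀ q v,
      mvfderiv 𝓘(ℝ, F) (fun q => g.val q (V q) (W q)) q v =
        g.val q (D V q v) (W q) + g.val q (V q) (D W q v) :=
    fun hV hW q v => hD.metric _ _ q (hV.mdiff q) (hW.mdiff q) v
  have h1 : ∀ V : VField F N, (fun q => mvfderiv 𝓘(ℝ, F) (fun q => g.val q (Z q) (Z q)) q (V q)) =
      (2 : ℝ) • fun q => g.val q (D Z q (V q)) (Z q) := by
    intro V
    ext1 q
    rw [hm hZ hZ, g.symm q (Z q), Pi.smul_apply, smul_eq_mul]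
    ring
  have h2 := mvfderiv_mlieBracket (hZ.metric hZ p (g := g)) (hX.near p) (hY.near p)
  have h3 : ∀ V W : VField F N, SmoothField V → SmoothField W →
      mvfderiv 𝓘(ℝ, F) ((2 : ℝ) • fun q => g.val q (D Z q (V q)) (Z q)) p (W p) =
        2 * (g.val p (D (fun q => D Z q (V q)) p (W p)) (Z p) +
          g.val p (D Z p (V p)) (D Z p (W p))) := by
    intro V W hV hW
    have hs := SmoothField.connection hD.smooth hV hZ
    have := mvfderiv_smul (I := 𝓘(ℝ, F)) (x := p) (a := fun _ : N => (2 : ℝ)) mdifferentiableAt_const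
      (hs.metric hZ p (g := g)).mdiff
    rw [← hm hs hZ]
    refine (congrArg (fun L => L (W p)) this).trans ?_
    rw [mvfderiv_const]
    simp
  rw [h1, h1, h3 Y X hY hX, h3 X Y hX hY, hm hZ hZ, g.symm p (Z p)] at h2
  rw [connCurv_apply]
  simp only [map_sub, sub_apply]
  have := g.symm p (D Z p (X p)) (D Z p (Y p))
  linarith

lemma connCurv_metric_skew (hD : IsLeviCivita g D) (hX : SmoothField X) (hY : SmoothField Y)
    (hZ : SmoothField Z) (hW : SmoothField W) (p : N) :
    g.val p (connCurv D X Y Z p) (W p) = -g.val p (connCurv D X Y W p) (Z p) := by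
  have h1 := connCurv_metric_skew_self hD hX hY hZ p
  have h2 := connCurv_metric_skew_self hD hX hY hW p
  have h3 := connCurv_metric_skew_self hD hX hY (hZ.add hW) p
  rw [connCurv_add_right hD.smooth hX hY hZ hW] at h3
  simp only [Pi.add_apply, map_add, add_apply] at h3
  linarith

/-- The curvature of a manifold of constant sectional curvature, at a point where there is a
nondegenerate tangent plane. -/
theorem HasConstantSectionalCurvature.connCurv_eq [T2Space N] (hD : IsLeviCivita g D) {c : ℝ}
    (hc : HasConstantSectionalCurvature g D c) {p : N}
    (hp : ∃ v w : TangentSpace 𝓘(ℝ, F) p, g.val p v v * g.val p w w - g.val p v w ^ 2 ≠ 0)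
    (hX : SmoothField X) (hY : SmoothField Y) (hZ : SmoothField Z) :
    connCurv D X Y Z p = c • (g.val p (Y p) (Z p) • X p - g.val p (X p) (Z p) • Y p) := by
  let V := smoothFields F N
  -- T is the deviation from the constant-curvature model at p. It is an algebraic curvature tensor
  -- that vanishes on nondegenerate planes, hence everywhere.
  let T : V → V → V → V → ℝ := fun X Y Z W =>
    g.val p (connCurv D X.1 Y.1 Z.1 p) (W.1 p) - c * (g.val p (Y.1 p) (Z.1 p) *
      g.val p (X.1 p) (W.1 p) - g.val p (X.1 p) (Z.1 p) * g.val p (Y.1 p) (W.1 p))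
  let B : V → V → ℝ := fun X Y => g.val p (X.1 p) (Y.1 p)
  have add₁ : ∀ x x' y z w, T (x + x') y z w = T x y z w + T x' y z w := by
    intro x x' y z w
    have := connCurv_add_left (Y := y.1) hD.smooth x.2 x'.2 z.2
    simp only [T, Submodule.coe_add, this, Pi.add_apply, map_add, add_apply]
    ring
  have smul₁ : ∀ (t : ℝ) x y z w, T (t • x) y z w = t * T x y z w := by
    intro t x y z w
    have := connCurv_smul_left (Y := y.1) hD.smooth t x.2 z.2
    simp only [T, Submodule.coe_smul, this, Pi.smul_apply, map_smul, smul_apply, smul_eq_mul]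
    ring
  have skew₁₂ : ∀ x y z w, T x y z w = -T y x z w := by
    intro x y z w
    simp only [T]
    rw [connCurv_swap, Pi.neg_apply, map_neg, neg_apply]
    ring
  have add₃ : ∀ x y z z' w, T x y (z + z') w = T x y z w + T x y z' w := by
    intro x y z z' w
    have := connCurv_add_right hD.smooth x.2 y.2 z.2 z'.2
    simp only [T, Submodule.coe_add, this, Pi.add_apply, map_add, add_apply]
    ring
  have smul₃ : ∀ (t : ℝ) x y z w, T x y (t • z) w = t * T x y z w := by
    intro t x y z w
    have := connCurv_smul_right hD.smooth t x.2 y.2 z.2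
    simp only [T, Submodule.coe_smul, this, Pi.smul_apply, map_smul, smul_apply, smul_eq_mul]
    ring
  have skew₃₄ : ∀ x y z w, T x y z w = -T x y w z := by
    intro x y z w
    simp only [T]
    rw [connCurv_metric_skew hD x.2 y.2 z.2 w.2]
    ring
  have bianchi : ∀ x y z w, T x y z w + T y z x w + T z x y w = 0 := by
    intro x y z w
    have h := congrArg (fun v => g.val p (v p) (w.1 p)) (connCurv_bianchi hD x.2 y.2 z.2)
    simp only [Pi.add_apply, map_add, add_apply, Pi.zero_apply, map_zero, zero_apply] at h
    simp only [T]
    rw [g.symm p (y.1 p) (x.1 p), g.symm p (z.1 p) (x.1 p), g.symm p (z.1 p) (y.1 p)]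
    linarith
  have hT : ∀ x y, B x x * B y y - B x y ^ 2 ≠ 0 → T x y y x = 0 := by
    intro x y hxy
    have h := hc x.1 y.1 x.2 y.2 p hxy
    rw [div_eq_iff hxy] at h
    simp only [T]
    rw [h, g.symm p (y.1 p) (x.1 p)]
    ring
  have hB : ∃ x y, B x x * B y y - B x y ^ 2 ≠ 0 := by
    obtain ⟨v, w, hvw⟩ := hp
    obtain ⟨x, hx, rfl⟩ := exists_smoothField_eq v
    obtain ⟨y, hy, rfl⟩ := exists_smoothField_eq w
    exact ⟨⟨x, hx⟩, ⟨y, hy⟩, hvw⟩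
  have h := eq_zero_of_sectional_eq_zero add₁ skew₁₂ add₃ skew₃₄ bianchi
    (sectional_eq_zero add₁ smul₁ skew₁₂ add₃ smul₃ skew₃₄ (B := B) (by simp [B]) (by simp [B])
      (fun x y => g.symm p _ _) hT hB) ⟨X, hX⟩ ⟨Y, hY⟩ ⟨Z, hZ⟩
  rw [← sub_eq_zero]
  refine g.nondegenerate p _ fun w => ?_
  obtain ⟨W, hW, rfl⟩ := exists_smoothField_eq w
  have := h ⟨W, hW⟩
  simp only [T] at this
  simp only [map_sub, map_smul, sub_apply, smul_apply, smul_eq_mul]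
  linarith

end LeviCivita

end

/-! ### Metric compatibility and vanishing torsion along a smooth map. -/

section

variable {E : Type*} [NormedAddCommGroup E] [NormedSpace ℝ E]
  {M : Type*} [TopologicalSpace M] [ChartedSpace E M]
  {F : Type*} [NormedAddCommGroup F] [NormedSpace ℝ F]
  {N : Type*} [TopologicalSpace N] [ChartedSpace F N]
  {G : Type*} [NormedAddCommGroup G] [NormedSpace ℝ G]

lemma mvfderiv_congr_apply {a b : M → G} {u : M} (hab : ∀ᶠ y in 𝓝 u, a y = b y)
    (x : TangentSpace 𝓘(ℝ, E) u) : mvfderiv 𝓘(ℝ, E) a u x = mvfderiv 𝓘(ℝ, E) b u x := by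
  rw [mvfderiv_congr_of_eventuallyEq hab]

lemma mvfderiv_add_apply {a b : M → G} {u : M} (ha : MDifferentiableAt 𝓘(ℝ, E) 𝓘(ℝ, G) a u)
    (hb : MDifferentiableAt 𝓘(ℝ, E) 𝓘(ℝ, G) b u) (x : TangentSpace 𝓘(ℝ, E) u) :
    mvfderiv 𝓘(ℝ, E) (fun y => a y + b y) u x =
      mvfderiv 𝓘(ℝ, E) a u x + mvfderiv 𝓘(ℝ, E) b u x :=
  congrArg (fun L => L x) (mvfderiv_add ha hb)

lemma mvfderiv_smul_apply {a : M → ℝ} {b : M → G} {u : M}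
    (ha : MDifferentiableAt 𝓘(ℝ, E) 𝓘(ℝ, ℝ) a u) (hb : MDifferentiableAt 𝓘(ℝ, E) 𝓘(ℝ, G) b u)
    (x : TangentSpace 𝓘(ℝ, E) u) :
    mvfderiv 𝓘(ℝ, E) (fun y => a y • b y) u x =
      a u • mvfderiv 𝓘(ℝ, E) b u x + mvfderiv 𝓘(ℝ, E) a u x • b u :=
  congrArg (fun L => L x) (mvfderiv_smul ha hb)

section Metric

variable [FiniteDimensional ℝ F] [T2Space N] [IsManifold 𝓘(ℝ, F) ∞ N]
  {g : SemiRiemannianMetric F N} {D : Connection F N} {f : M → N} {u : M}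
  {V W : Π u : M, TangentSpace 𝓘(ℝ, F) (f u)}

/-- The metric is parallel along any smooth map. -/
theorem IsLeviCivita.mvfderiv_metric_along (hD : IsLeviCivita g D)
    (hf : ContMDiff 𝓘(ℝ, E) 𝓘(ℝ, F) ∞ f) (hV : SmoothAlongNear (E := E) f V u)
    (hW : SmoothAlongNear (E := E) f W u) (x : TangentSpace 𝓘(ℝ, E) u) :
    mvfderiv 𝓘(ℝ, E) (fun y => g.val (f y) (V y) (W y)) u x =
      g.val (f u) (covAlong D f V u x) (W u) + g.val (f u) (V u) (covAlong D f W u x) := by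
  -- Reduces the first slot to ambient fields. It is used once per slot, the symmetry of g
  -- exchanging the two.
  have step : ∀ W : Π u : M, TangentSpace 𝓘(ℝ, F) (f u), SmoothAlongNear (E := E) f W u →
      (∀ Y : VField F N, SmoothField Y →
        mvfderiv 𝓘(ℝ, E) (fun y => g.val (f y) (Y (f y)) (W y)) u x =
          g.val (f u) (covAlong D f (fun y => Y (f y)) u x) (W u) +
            g.val (f u) (Y (f u)) (covAlong D f W u x)) →
      ∀ V : Π u : M, TangentSpace 𝓘(ℝ, F) (f u), SmoothAlongNear (E := E) f V u →
        mvfderiv 𝓘(ℝ, E) (fun y => g.val (f y) (V y) (W y)) u x =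
          g.val (f u) (covAlong D f V u x) (W u) + g.val (f u) (V u) (covAlong D f W u x) := by
    intro W hW hcomp V hV
    refine SmoothAlongNear.induction (u := u) hf
      (P := fun V => mvfderiv 𝓘(ℝ, E) (fun y => g.val (f y) (V y) (W y)) u x =
        g.val (f u) (covAlong D f V u x) (W u) + g.val (f u) (V u) (covAlong D f W u x))
      hcomp ?_ ?_ ?_ hV
    · intro V V' hV hV' h h'
      simp only [Pi.add_apply, map_add, add_apply]
      rw [mvfderiv_add_apply (hV.metric g hW).mdiff (hV'.metric g hW).mdiff, h, h',
        covAlong_add hV hV', map_add, add_apply]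
      ring
    · intro a V ha hV h
      simp only [Pi.smul_apply', map_smul, smul_apply]
      rw [mvfderiv_smul_apply ha.mdiff (hV.metric g hW).mdiff, h, covAlong_smul ha hV, map_add,
        map_smul, map_smul, add_apply, smul_apply, smul_apply]
      simp only [smul_eq_mul]
      ring
    · intro V V' hV hVV' h
      rw [← covAlong_congr hVV', ← hVV'.self_of_nhds, ← h]
      refine mvfderiv_congr_apply ?_ x
      filter_upwards [hVV'] with y hy
      rw [hy]
  refine step W hW ?_ V hV
  intro Y hY
  have hY' := hY.comp_along hf u
  have hsymm : ∀ A B : Π u : M, TangentSpace 𝓘(ℝ, F) (f u),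
      (fun y => g.val (f y) (A y) (B y)) = fun y => g.val (f y) (B y) (A y) :=
    fun A B => funext fun y => g.symm _ _ _
  have h := step (fun y => Y (f y)) hY' ?_ W hW
  · rw [hsymm, h, g.symm, g.symm (f u) (W u), add_comm]
  · intro Z hZ
    have hfu : MDifferentiableAt 𝓘(ℝ, E) 𝓘(ℝ, F) f u := hf.contMDiffAt.mdifferentiableAt (by simp)
    rw [covAlong_comp (hZ.mdiff _) hfu, covAlong_comp (hY.mdiff _) hfu,
      mvfderiv_comp_map_apply (h := fun q => g.val q (Z q) (Y q)) (hZ.metric hY (f u)).mdiff hfu]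
    exact hD.metric Z Y (f u) (hZ.mdiff _) (hY.mdiff _) _

end Metric

section Hessian

variable [IsManifold 𝓘(ℝ, F) ∞ N] {D : Connection F N} {f : M → N} {u : M}

/-- The field is only assumed differentiable at the point because `TensorialAt` quantifies over such
fields. -/
lemma MDifferentiableAt.mvfderiv_along [IsManifold 𝓘(ℝ, E) ∞ M] {h : N → G} (hh : ContMDiffAt 𝓘(ℝ, F) 𝓘(ℝ, G) ∞ h (f u))
    (hf : ContMDiffAt 𝓘(ℝ, E) 𝓘(ℝ, F) ∞ f u) {A : Π u : M, TangentSpace 𝓘(ℝ, F) (f u)}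
    (hA : MDifferentiableAt 𝓘(ℝ, E) 𝓘(ℝ, F).tangent
      (fun y => (⟨f y, A y⟩ : TangentBundle 𝓘(ℝ, F) N)) u) :
    MDifferentiableAt 𝓘(ℝ, E) 𝓘(ℝ, G) (fun y => mvfderiv 𝓘(ℝ, F) h (f y) (A y)) u := by
  have h1 := ContMDiffAt.mfderiv (m := 1) (fun _ : M => h) f
    (ContMDiffAt.comp (u, f u) hh contMDiffAt_snd) (hf.of_le (by norm_cast))
    (by norm_cast)
  have h2 := MDifferentiableAt.clm_apply_of_inCoordinates (h1.mdifferentiableAt (by simp)) hA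
    ((hh.comp u hf).mdifferentiableAt (by simp))
  exact ((contMDiff_snd_tangentBundle_modelSpace (n := 1) G 𝓘(ℝ, G)).contMDiffAt.mdifferentiableAt
    (by simp)).comp u h2

/-- Multiplying W by a function produces the same derivative term in d(dh(W)) and in dh(D W), so the
difference is linear over functions. -/
lemma hessian_tensorial {h : N → G} {p : N} (hh : ContMDiffAt 𝓘(ℝ, F) 𝓘(ℝ, G) ∞ h p) :
    TensorialAt 𝓘(ℝ, F) F (fun W : VField F N =>
      mvfderiv 𝓘(ℝ, F) (fun q => mvfderiv 𝓘(ℝ, F) h q (W q)) p -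
        (mvfderiv 𝓘(ℝ, F) h p).comp (D W p)) p where
  add {Y Z} hY hZ := by
    have hY' : MDifferentiableAt 𝓘(ℝ, F) 𝓘(ℝ, G) (fun q => mvfderiv 𝓘(ℝ, F) h q (Y q)) p :=
      MDifferentiableAt.mvfderiv_along (f := id) hh contMDiffAt_id hY
    have hZ' : MDifferentiableAt 𝓘(ℝ, F) 𝓘(ℝ, G) (fun q => mvfderiv 𝓘(ℝ, F) h q (Z q)) p :=
      MDifferentiableAt.mvfderiv_along (f := id) hh contMDiffAt_id hZ
    ext v
    rw [D.isCovariantDerivativeOn.add (s := Set.univ) hY hZ trivial]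
    simp only [Pi.add_apply, map_add, sub_apply, add_apply, ContinuousLinearMap.comp_apply]
    rw [mvfderiv_add_apply hY' hZ']
    abel
  smul {a Y} ha hY := by
    have hY' : MDifferentiableAt 𝓘(ℝ, F) 𝓘(ℝ, G) (fun q => mvfderiv 𝓘(ℝ, F) h q (Y q)) p :=
      MDifferentiableAt.mvfderiv_along (f := id) hh contMDiffAt_id hY
    ext v
    rw [D.isCovariantDerivativeOn.leibniz (s := Set.univ) hY ha trivial]
    simp only [Pi.smul_apply', map_smul, map_add, sub_apply, add_apply, smul_apply,
      ContinuousLinearMap.comp_apply, ContinuousLinearMap.smulRight_apply]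
    rw [mvfderiv_smul_apply ha hY']
    module

variable [FiniteDimensional ℝ F]

/-- The Hessian of a function, as a bilinear form. -/
lemma exists_hessian (D : Connection F N) {h : N → G} {p : N}
    (hh : ContMDiffAt 𝓘(ℝ, F) 𝓘(ℝ, G) ∞ h p) :
    ∃ H : TangentSpace 𝓘(ℝ, F) p →ₗ[ℝ] TangentSpace 𝓘(ℝ, F) p →L[ℝ] G,
      ∀ W : VField F N, SmoothField W → ∀ v,
        mvfderiv 𝓘(ℝ, F) (fun q => mvfderiv 𝓘(ℝ, F) h q (W q)) p v =
          H (W p) v + mvfderiv 𝓘(ℝ, F) h p (D W p v) := by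
  refine ⟨(TensorialAt.mkHom _ p (hessian_tensorial (D := D) hh)).toLinearMap, fun W hW v => ?_⟩
  have := congrArg (fun L => L v)
    ((hessian_tensorial (D := D) hh).mkHom_apply (hW.mdiff p))
  simp only [sub_apply, ContinuousLinearMap.comp_apply] at this
  refine eq_add_of_sub_eq ?_
  exact this.symm

variable [T2Space N]

lemma mvfderiv_mvfderiv_along [IsManifold 𝓘(ℝ, E) ∞ M] {h : N → G} (hf : ContMDiff 𝓘(ℝ, E) 𝓘(ℝ, F) ∞ f)
    (hh : ContMDiffAt 𝓘(ℝ, F) 𝓘(ℝ, G) ∞ h (f u))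
    {H : TangentSpace 𝓘(ℝ, F) (f u) →ₗ[ℝ] TangentSpace 𝓘(ℝ, F) (f u) →L[ℝ] G}
    (hH : ∀ W : VField F N, SmoothField W → ∀ v,
        mvfderiv 𝓘(ℝ, F) (fun q => mvfderiv 𝓘(ℝ, F) h q (W q)) (f u) v =
          H (W (f u)) v + mvfderiv 𝓘(ℝ, F) h (f u) (D W (f u) v))
    {A : Π u : M, TangentSpace 𝓘(ℝ, F) (f u)} (hA : SmoothAlongNear (E := E) f A u)
    (x : TangentSpace 𝓘(ℝ, E) u) :
    mvfderiv 𝓘(ℝ, E) (fun y => mvfderiv 𝓘(ℝ, F) h (f y) (A y)) u x =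
      H (A u) (mfderiv 𝓘(ℝ, E) 𝓘(ℝ, F) f u x) +
        mvfderiv 𝓘(ℝ, F) h (f u) (covAlong D f A u x) := by
  have hfu : MDifferentiableAt 𝓘(ℝ, E) 𝓘(ℝ, F) f u := hf.contMDiffAt.mdifferentiableAt (by simp)
  have hd : ∀ {A : Π u : M, TangentSpace 𝓘(ℝ, F) (f u)}, SmoothAlongNear (E := E) f A u →
      MDifferentiableAt 𝓘(ℝ, E) 𝓘(ℝ, G) (fun y => mvfderiv 𝓘(ℝ, F) h (f y) (A y)) u :=
    fun hA => MDifferentiableAt.mvfderiv_along hh hf.contMDiffAt (hA.at.mdifferentiableAt (by simp))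
  refine SmoothAlongNear.induction (u := u) hf
    (P := fun A => mvfderiv 𝓘(ℝ, E) (fun y => mvfderiv 𝓘(ℝ, F) h (f y) (A y)) u x =
      H (A u) (mfderiv 𝓘(ℝ, E) 𝓘(ℝ, F) f u x) +
        mvfderiv 𝓘(ℝ, F) h (f u) (covAlong D f A u x)) ?_ ?_ ?_ ?_ hA
  · intro Y hY
    rw [mvfderiv_comp_map_apply (h := fun q => mvfderiv 𝓘(ℝ, F) h q (Y q))
      (MDifferentiableAt.mvfderiv_along (f := id) hh contMDiffAt_id (hY.mdiff _)) hfu, hH Y hY,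
      covAlong_comp (hY.mdiff _) hfu]
  · intro V W hV hW h1 h2
    simp only [Pi.add_apply, map_add]
    rw [mvfderiv_add_apply (hd hV) (hd hW), h1, h2, covAlong_add hV hW, add_apply, map_add]
    abel
  · intro a V ha hV h1
    simp only [Pi.smul_apply', map_smul]
    rw [mvfderiv_smul_apply ha.mdiff (hd hV), h1, covAlong_smul ha hV, smul_apply, map_add,
      map_smul, map_smul]
    module
  · intro V W hV hVW h1
    rw [← covAlong_congr hVW, ← hVW.self_of_nhds, ← h1]
    refine mvfderiv_congr_apply ?_ x
    filter_upwards [hVW] with y hy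
    rw [hy]

variable {g : SemiRiemannianMetric F N}

/-- The Levi-Civita connection is torsion-free along any smooth map. -/
theorem IsLeviCivita.torsion_free_along [CompleteSpace E] [IsManifold 𝓘(ℝ, E) ∞ M]
    (hD : IsLeviCivita g D) (hf : ContMDiff 𝓘(ℝ, E) 𝓘(ℝ, F) ∞ f) {X Y : VField E M}
    (hX : SmoothFieldNear X u) (hY : SmoothFieldNear Y u) :
    mfderiv 𝓘(ℝ, E) 𝓘(ℝ, F) f u (VectorField.mlieBracket 𝓘(ℝ, E) X Y u) =
      covAlong D f (fun y => mfderiv 𝓘(ℝ, E) 𝓘(ℝ, F) f y (Y y)) u (X u) -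
        covAlong D f (fun y => mfderiv 𝓘(ℝ, E) 𝓘(ℝ, F) f y (X y)) u (Y u) := by
  -- The test function is the F-valued chart at f u: its differential at f u is injective, so an
  -- identity of tangent vectors can be checked after applying it.
  set h := extChartAt 𝓘(ℝ, F) (f u) with hdef
  have hh : SmoothFunNear (E := F) h (f u) := by
    filter_upwards [extChartAt_source_mem_nhds (I := 𝓘(ℝ, F)) (f u)] with q hq
    exact contMDiffAt_extChartAt' (by rwa [extChartAt_source] at hq)
  obtain ⟨H, hH⟩ := exists_hessian D hh.at
  -- The Hessian is symmetric because the ambient connection has no torsion; the Hessian terms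
  -- therefore cancel in the commutator along f.
  have hsymm : ∀ v w, H v w = H w v := by
    intro v w
    obtain ⟨V, hV, rfl⟩ := exists_smoothField_eq v
    obtain ⟨W, hW, rfl⟩ := exists_smoothField_eq w
    have h1 := mvfderiv_mlieBracket hh (hV.near _) (hW.near _)
    rw [hH _ hV, hH _ hW, ← hD.torsion_free hV hW, map_sub] at h1
    have h2 : H (V (f u)) (W (f u)) - H (W (f u)) (V (f u)) = 0 := by
      linear_combination (norm := module) h1
    exact sub_eq_zero.1 h2
  have hchain : ∀ᶠ y in 𝓝 u, ∀ x, mvfderiv 𝓘(ℝ, E) (fun y => h (f y)) y x =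
      mvfderiv 𝓘(ℝ, F) h (f y) (mfderiv 𝓘(ℝ, E) 𝓘(ℝ, F) f y x) := by
    filter_upwards [hf.continuous.continuousAt.eventually hh] with y hy x
    exact mvfderiv_comp_map_apply (hy.mdifferentiableAt (by simp))
      (hf.contMDiffAt.mdifferentiableAt (by simp)) x
  have hhf : SmoothFunNear (E := E) (fun y => h (f y)) u := by
    filter_upwards [hf.continuous.continuousAt.eventually hh] with y hy
    exact hy.comp y hf.contMDiffAt
  have key : ∀ Z : VField E M, SmoothFieldNear Z u → ∀ x,
      mvfderiv 𝓘(ℝ, E) (fun y => mvfderiv 𝓘(ℝ, E) (fun y => h (f y)) y (Z y)) u x =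
        H (mfderiv 𝓘(ℝ, E) 𝓘(ℝ, F) f u (Z u)) (mfderiv 𝓘(ℝ, E) 𝓘(ℝ, F) f u x) +
          mvfderiv 𝓘(ℝ, F) h (f u)
            (covAlong D f (fun y => mfderiv 𝓘(ℝ, E) 𝓘(ℝ, F) f y (Z y)) u x) := by
    intro Z hZ x
    rw [← mvfderiv_mvfderiv_along hf hh.at hH (hZ.mfderiv_apply hf)]
    refine mvfderiv_congr_apply ?_ x
    filter_upwards [hchain] with y hy
    exact hy _
  have h1 := mvfderiv_mlieBracket hhf hX hY
  rw [key X hX, key Y hY, hchain.self_of_nhds, hsymm] at h1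
  have hinj : Function.Injective (mvfderiv 𝓘(ℝ, F) h (f u)) :=
    (isInvertible_mfderiv_extChartAt (I := 𝓘(ℝ, F)) (mem_extChartAt_source (f u))).injective
  apply hinj
  rw [h1, map_sub]
  abel

end Hessian

end

/-! ### Curvature of the ambient connection along a map. -/

section

variable {E : Type*} [NormedAddCommGroup E] [NormedSpace ℝ E]
  {M : Type*} [TopologicalSpace M] [ChartedSpace E M]
  {F : Type*} [NormedAddCommGroup F] [NormedSpace ℝ F]
  {N : Type*} [TopologicalSpace N] [ChartedSpace F N] [IsManifold 𝓘(ℝ, F) ∞ N]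
  {D : Connection F N} {f : M → N} {u : M}

lemma SmoothField.contMDiff_connection
    (hD : CovariantDerivative.ContMDiffCovariantDerivative D ∞) {Z : VField F N}
    (hZ : SmoothField Z) (p : N) :
    ContMDiffAt 𝓘(ℝ, F) (𝓘(ℝ, F).prod 𝓘(ℝ, F →L[ℝ] F)) ∞
      (fun p => Bundle.TotalSpace.mk' (F →L[ℝ] F)
        (E := fun p : N => TangentSpace 𝓘(ℝ, F) p →L[ℝ] TangentSpace 𝓘(ℝ, F) p) p (D Z p)) p :=
  (hD.contMDiff.contMDiff (σ := Z) (by simpa using! hZ.contMDiffOn)).contMDiffAt univ_mem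

lemma SmoothAlongNear.connection_apply
    (hD : CovariantDerivative.ContMDiffCovariantDerivative D ∞) {Z : VField F N}
    (hZ : SmoothField Z) {A : Π u : M, TangentSpace 𝓘(ℝ, F) (f u)}
    (hA : SmoothAlongNear (E := E) f A u) :
    SmoothAlongNear (E := E) f (fun y => D Z (f y) (A y)) u := by
  filter_upwards [hA] with y hy
  exact ContMDiffAt.clm_bundle_apply
    ((hZ.contMDiff_connection hD (f y)).comp y (contMDiffAt_along_iff.1 hy).1) hy

/-- The expression is the second covariant derivative of Z; the term D Z ∘ D W removes the
derivatives of W. -/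
lemma connection_apply_tensorial (hD : CovariantDerivative.ContMDiffCovariantDerivative D ∞)
    {Z : VField F N} (hZ : SmoothField Z) (p : N) :
    TensorialAt 𝓘(ℝ, F) F (fun W : VField F N =>
      D (fun q => D Z q (W q)) p - (D Z p).comp (D W p)) p where
  add {X Y} hX hY := by
    have hd := (hZ.contMDiff_connection hD p).mdifferentiableAt (by simp)
    have h : (fun q => D Z q ((X + Y) q)) = (fun q => D Z q (X q)) + fun q => D Z q (Y q) := by
      ext1 q; simp
    rw [h, D.isCovariantDerivativeOn.add (s := Set.univ) hX hY trivial,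
      D.isCovariantDerivativeOn.add (s := Set.univ) (hd.clm_bundle_apply hX)
        (hd.clm_bundle_apply hY) trivial, ContinuousLinearMap.comp_add]
    abel
  smul {a X} ha hX := by
    have hd := (hZ.contMDiff_connection hD p).mdifferentiableAt (by simp)
    have h : (fun q => D Z q ((a • X) q)) = a • fun q => D Z q (X q) := by
      ext1 q; simp
    rw [h, D.isCovariantDerivativeOn.leibniz (s := Set.univ) hX ha trivial,
      D.isCovariantDerivativeOn.leibniz (s := Set.univ) (hd.clm_bundle_apply hX) ha trivial]
    ext v
    simp only [sub_apply, add_apply, smul_apply, ContinuousLinearMap.comp_apply, map_add, map_smul,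
      ContinuousLinearMap.smulRight_apply]
    module

variable [FiniteDimensional ℝ F]

/-- The second covariant derivative of a smooth vector field, as a bilinear map. -/
lemma exists_second_derivative (hD : CovariantDerivative.ContMDiffCovariantDerivative D ∞)
    {Z : VField F N} (hZ : SmoothField Z) (p : N) :
    ∃ H : TangentSpace 𝓘(ℝ, F) p →ₗ[ℝ] TangentSpace 𝓘(ℝ, F) p →L[ℝ] TangentSpace 𝓘(ℝ, F) p,
      ∀ W : VField F N, SmoothField W → ∀ v,
        D (fun q => D Z q (W q)) p v = H (W p) v + D Z p (D W p v) := by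
  refine ⟨(TensorialAt.mkHom _ p (connection_apply_tensorial hD hZ p)).toLinearMap,
    fun W hW v => ?_⟩
  have := congrArg (fun L => L v)
    ((connection_apply_tensorial hD hZ p).mkHom_apply (hW.mdiff p))
  simp only [sub_apply, ContinuousLinearMap.comp_apply] at this
  refine eq_add_of_sub_eq ?_
  exact this.symm

variable [T2Space N]

lemma covAlong_connection_apply (hD : CovariantDerivative.ContMDiffCovariantDerivative D ∞)
    (hf : ContMDiff 𝓘(ℝ, E) 𝓘(ℝ, F) ∞ f) {Z : VField F N} (hZ : SmoothField Z)
    {H : TangentSpace 𝓘(ℝ, F) (f u) →ₗ[ℝ]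
      TangentSpace 𝓘(ℝ, F) (f u) →L[ℝ] TangentSpace 𝓘(ℝ, F) (f u)}
    (hH : ∀ W : VField F N, SmoothField W → ∀ v,
        D (fun q => D Z q (W q)) (f u) v = H (W (f u)) v + D Z (f u) (D W (f u) v))
    {A : Π u : M, TangentSpace 𝓘(ℝ, F) (f u)} (hA : SmoothAlongNear (E := E) f A u)
    (x : TangentSpace 𝓘(ℝ, E) u) :
    covAlong D f (fun y => D Z (f y) (A y)) u x =
      H (A u) (mfderiv 𝓘(ℝ, E) 𝓘(ℝ, F) f u x) + D Z (f u) (covAlong D f A u x) := by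
  have hfu : MDifferentiableAt 𝓘(ℝ, E) 𝓘(ℝ, F) f u := hf.contMDiffAt.mdifferentiableAt (by simp)
  refine SmoothAlongNear.induction (u := u) hf
    (P := fun A => covAlong D f (fun y => D Z (f y) (A y)) u x =
      H (A u) (mfderiv 𝓘(ℝ, E) 𝓘(ℝ, F) f u x) + D Z (f u) (covAlong D f A u x)) ?_ ?_ ?_ ?_ hA
  · intro Y hY
    rw [covAlong_comp (Y := fun q => D Z q (Y q)) ((hY.connection hD hZ).mdiff _) hfu, hH Y hY,
      covAlong_comp (hY.mdiff _) hfu]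
  · intro V W hV hW h1 h2
    have h : (fun y => D Z (f y) ((V + W) y)) =
        (fun y => D Z (f y) (V y)) + fun y => D Z (f y) (W y) := by
      ext1 y; simp
    rw [h, covAlong_add (hV.connection_apply hD hZ) (hW.connection_apply hD hZ), h1, h2,
      covAlong_add hV hW, Pi.add_apply, map_add, map_add, add_apply]
    abel
  · intro a V ha hV h1
    have h : (fun y => D Z (f y) ((a • V) y)) = a • fun y => D Z (f y) (V y) := by
      ext1 y; simp
    rw [h, covAlong_smul ha (hV.connection_apply hD hZ), h1, covAlong_smul ha hV, Pi.smul_apply',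
      map_smul, map_add, map_smul, map_smul, smul_apply]
    module
  · intro V W hV hVW h1
    rw [← covAlong_congr hVW, ← hVW.self_of_nhds, ← h1]
    refine covAlong_congr ?_ x
    filter_upwards [hVW] with y hy
    rw [hy]

variable [FiniteDimensional ℝ E] [IsManifold 𝓘(ℝ, E) ∞ M] {g : SemiRiemannianMetric F N}

/-- The curvature of the ambient connection along a smooth map into a manifold of constant
curvature. -/
theorem HasConstantSectionalCurvature.curvature_along (hD : IsLeviCivita g D) {c : ℝ}
    (hc : HasConstantSectionalCurvature g D c)
    (hp : ∃ v w : TangentSpace 𝓘(ℝ, F) (f u),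
      g.val (f u) v v * g.val (f u) w w - g.val (f u) v w ^ 2 ≠ 0)
    (hf : ContMDiff 𝓘(ℝ, E) 𝓘(ℝ, F) ∞ f) {X Y : VField E M}
    (hX : SmoothFieldNear X u) (hY : SmoothFieldNear Y u)
    {V : Π u : M, TangentSpace 𝓘(ℝ, F) (f u)} (hV : SmoothAlongNear (E := E) f V u) :
    covAlong D f (fun y => covAlong D f V y (Y y)) u (X u) -
      covAlong D f (fun y => covAlong D f V y (X y)) u (Y u) -
      covAlong D f V u (VectorField.mlieBracket 𝓘(ℝ, E) X Y u) =
    c • (g.val (f u) (mfderiv 𝓘(ℝ, E) 𝓘(ℝ, F) f u (Y u)) (V u) •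
          mfderiv 𝓘(ℝ, E) 𝓘(ℝ, F) f u (X u) -
        g.val (f u) (mfderiv 𝓘(ℝ, E) 𝓘(ℝ, F) f u (X u)) (V u) •
          mfderiv 𝓘(ℝ, E) 𝓘(ℝ, F) f u (Y u)) := by
  have hfd : ∀ y, MDifferentiableAt 𝓘(ℝ, E) 𝓘(ℝ, F) f y :=
    fun y => hf.contMDiffAt.mdifferentiableAt (by simp)
  refine SmoothAlongNear.induction (u := u) hf
    (P := fun V => covAlong D f (fun y => covAlong D f V y (Y y)) u (X u) -
      covAlong D f (fun y => covAlong D f V y (X y)) u (Y u) -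
      covAlong D f V u (VectorField.mlieBracket 𝓘(ℝ, E) X Y u) =
    c • (g.val (f u) (mfderiv 𝓘(ℝ, E) 𝓘(ℝ, F) f u (Y u)) (V u) •
          mfderiv 𝓘(ℝ, E) 𝓘(ℝ, F) f u (X u) -
        g.val (f u) (mfderiv 𝓘(ℝ, E) 𝓘(ℝ, F) f u (X u)) (V u) •
          mfderiv 𝓘(ℝ, E) 𝓘(ℝ, F) f u (Y u))) ?_ ?_ ?_ ?_ hV
  · intro Z hZ
    obtain ⟨H, hH⟩ := exists_second_derivative hD.smooth hZ (f u)
    have h1 : ∀ X : VField E M, (fun y => covAlong D f (fun y => Z (f y)) y (X y)) =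
        fun y => D Z (f y) (mfderiv 𝓘(ℝ, E) 𝓘(ℝ, F) f y (X y)) := by
      intro X; ext1 y; exact covAlong_comp (hZ.mdiff _) (hfd y) _
    rw [h1, h1, covAlong_comp (hZ.mdiff _) (hfd u),
      covAlong_connection_apply hD.smooth hf hZ hH (hX.mfderiv_apply hf),
      covAlong_connection_apply hD.smooth hf hZ hH (hY.mfderiv_apply hf),
      hD.torsion_free_along hf hX hY, map_sub]
    -- The skew part of the second covariant derivative is the ambient curvature, known in constant
    -- curvature. The first-order terms were absorbed by vanishing torsion along f.
    have h2 : ∀ v w, H w v - H v w = c • (g.val (f u) w (Z (f u)) • v -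
        g.val (f u) v (Z (f u)) • w) := by
      intro v w
      obtain ⟨A, hA, rfl⟩ := exists_smoothField_eq v
      obtain ⟨B, hB, rfl⟩ := exists_smoothField_eq w
      rw [← hc.connCurv_eq hD hp hA hB hZ, connCurv_apply, hH _ hA, hH _ hB,
        ← hD.torsion_free hA hB, map_sub]
      module
    rw [← h2]
    module
  · intro V W hV hW h1 h2
    have h3 : ∀ {X : VField E M}, SmoothFieldNear X u → ∀ x : TangentSpace 𝓘(ℝ, E) u,
        covAlong D f (fun y => covAlong D f (V + W) y (X y)) u x =
          covAlong D f (fun y => covAlong D f V y (X y)) u x +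
            covAlong D f (fun y => covAlong D f W y (X y)) u x := by
      intro X hX x
      rw [← covAlong_add (hV.covAlong_apply hD.smooth hf hX) (hW.covAlong_apply hD.smooth hf hX)]
      refine covAlong_congr ?_ x
      filter_upwards [hV.eventually, hW.eventually] with y hy hy'
      exact covAlong_add hy hy' _
    rw [h3 hX, h3 hY, covAlong_add hV hW]
    simp only [Pi.add_apply, map_add]
    linear_combination (norm := module) h1 + h2
  · intro a V ha hV h1
    have h3 : ∀ {X : VField E M}, SmoothFieldNear X u → ∀ x : TangentSpace 𝓘(ℝ, E) u,
        covAlong D f (fun y => covAlong D f (a • V) y (X y)) u x =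
          mvfderiv 𝓘(ℝ, E) (fun y => mvfderiv 𝓘(ℝ, E) a y (X y)) u x • V u +
          mvfderiv 𝓘(ℝ, E) a u (X u) • covAlong D f V u x +
          mvfderiv 𝓘(ℝ, E) a u x • covAlong D f V u (X u) +
          a u • covAlong D f (fun y => covAlong D f V y (X y)) u x := by
      intro X hX x
      have hV' := hV.covAlong_apply hD.smooth hf hX
      have ha' := ha.mvfderiv_apply hX
      have h4 := covAlong_add (D := D) (hV.smul ha') (hV'.smul ha) x
      rw [covAlong_smul ha' hV, covAlong_smul ha hV'] at h4
      rw [add_assoc _ (mvfderiv 𝓘(ℝ, E) a u x • _), ← h4]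
      refine covAlong_congr ?_ x
      filter_upwards [ha.eventually, hV.eventually] with y hy hy'
      exact covAlong_smul hy hy' _
    -- The mixed first-order terms are symmetric in X and Y, and the second derivatives of a cancel
    -- against its derivative along [X,Y]; the operator is thus linear over functions in V.
    rw [h3 hX, h3 hY, covAlong_smul ha hV, mvfderiv_mlieBracket ha hX hY]
    simp only [Pi.smul_apply', map_smul, smul_eq_mul]
    linear_combination (norm := module) a u • h1
  · intro V W hV hVW h1
    have h3 : ∀ (X : VField E M) (x : TangentSpace 𝓘(ℝ, E) u),
        covAlong D f (fun y => covAlong D f V y (X y)) u x =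
          covAlong D f (fun y => covAlong D f W y (X y)) u x := by
      intro X x
      refine covAlong_congr ?_ x
      filter_upwards [eventually_eventually_nhds.2 hVW] with y hy
      exact covAlong_congr hy _
    rw [← h3, ← h3, ← covAlong_congr hVW, ← hVW.self_of_nhds, h1]

end

/-! ### Lifting smoothness through an immersion. -/

section

variable {E : Type*} [NormedAddCommGroup E] [NormedSpace ℝ E] [FiniteDimensional ℝ E]
  {M : Type*} [TopologicalSpace M] [ChartedSpace E M] [IsManifold 𝓘(ℝ, E) ∞ M]
  {F : Type*} [NormedAddCommGroup F] [NormedSpace ℝ F]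
  {N : Type*} [TopologicalSpace N] [ChartedSpace F N] [IsManifold 𝓘(ℝ, F) ∞ N]
  {f : M → N} {u : M} {Y : VField E M}

/-- A vector field whose image under an immersion is smooth is smooth. -/
lemma contMDiffAt_of_mfderiv_apply [FiniteDimensional ℝ F]
    (hf : ContMDiffAt 𝓘(ℝ, E) 𝓘(ℝ, F) ∞ f u)
    (hinj : Function.Injective (mfderiv 𝓘(ℝ, E) 𝓘(ℝ, F) f u))
    (hY : ContMDiffAt 𝓘(ℝ, E) 𝓘(ℝ, F).tangent ∞
      (fun y => (⟨f y, mfderiv 𝓘(ℝ, E) 𝓘(ℝ, F) f y (Y y)⟩ : TangentBundle 𝓘(ℝ, F) N)) u) :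
    ContMDiffAt 𝓘(ℝ, E) 𝓘(ℝ, E).tangent ∞
      (fun y => (⟨y, Y y⟩ : TangentBundle 𝓘(ℝ, E) M)) u := by
  have : CompleteSpace E := FiniteDimensional.complete ℝ E
  let Φ : M → E →L[ℝ] F :=
    inTangentCoordinates 𝓘(ℝ, E) 𝓘(ℝ, F) id f (mfderiv 𝓘(ℝ, E) 𝓘(ℝ, F) f) u
  have hΦ : ContMDiffAt 𝓘(ℝ, E) 𝓘(ℝ, E →L[ℝ] F) ∞ Φ u := hf.mfderiv_const (m := ∞) (by simp)
  let t := trivializationAt E (TangentSpace 𝓘(ℝ, E) : M → Type _) u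
  let s := trivializationAt F (TangentSpace 𝓘(ℝ, F) : N → Type _) (f u)
  have htu : u ∈ t.baseSet := FiberBundle.mem_baseSet_trivializationAt' u
  have hsu : f u ∈ s.baseSet := FiberBundle.mem_baseSet_trivializationAt' (f u)
  have hΦinj : Function.Injective (Φ u) := by
    intro v w hvw
    have h1 : ∀ v, Φ u v = s.continuousLinearMapAt ℝ (f u)
        (mfderiv 𝓘(ℝ, E) 𝓘(ℝ, F) f u (t.symmL ℝ u v)) := fun v => rfl
    rw [h1, h1] at hvw
    have hs : Function.Injective (s.continuousLinearMapAt ℝ (f u)) :=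
      Function.LeftInverse.injective (g := s.symmL ℝ (f u)) (s.symmL_continuousLinearMapAt hsu)
    have ht : Function.Injective (t.symmL ℝ u) :=
      Function.LeftInverse.injective (g := t.continuousLinearMapAt ℝ u)
        (t.continuousLinearMapAt_symmL htu)
    exact ht (hinj (hs hvw))
  -- A left inverse of df at u, in coordinates, composes with df at nearby points to an invertible
  -- endomorphism of E. The components of Y are the inverse of this endomorphism applied to L of the
  -- components of df(Y).
  obtain ⟨L, hL⟩ := (Φ u).toLinearMap.exists_leftInverse_of_injective (LinearMap.ker_eq_bot.2 hΦinj)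
  let L' : F →L[ℝ] E := LinearMap.toContinuousLinearMap L
  have hA : ContMDiffAt 𝓘(ℝ, E) 𝓘(ℝ, E →L[ℝ] E) ∞ (fun y => L'.comp (Φ y)) u :=
    contMDiffAt_const.clm_comp hΦ
  have hAu : L'.comp (Φ u) = ContinuousLinearMap.id ℝ E := by
    ext v
    exact congrArg (fun l => l v) hL
  have hinv : ContMDiffAt 𝓘(ℝ, E) 𝓘(ℝ, E →L[ℝ] E) ∞
      (fun y => ContinuousLinearMap.inverse (L'.comp (Φ y))) u := by
    have h1 : ContDiffAt ℝ ∞ (ContinuousLinearMap.inverse : (E →L[ℝ] E) → E →L[ℝ] E)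
        (L'.comp (Φ u)) := by
      rw [hAu]
      exact contDiffAt_map_inverse (ContinuousLinearEquiv.refl ℝ E)
    exact h1.contMDiffAt.comp u hA
  have hunit : ∀ᶠ y in 𝓝 u, (L'.comp (Φ y)).IsInvertible := by
    have h1 : {B : E →L[ℝ] E | B.IsInvertible} ∈ 𝓝 (L'.comp (Φ u)) := by
      rw [hAu]
      exact ContinuousLinearEquiv.nhds (ContinuousLinearEquiv.refl ℝ E)
    exact hA.continuousAt h1
  rw [contMDiffAt_totalSpace]
  refine ⟨contMDiffAt_id, ?_⟩
  refine (hinv.clm_apply ((contMDiffAt_const (c := L')).clm_apply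
    (contMDiffAt_along_iff.1 hY).2)).congr_of_eventuallyEq ?_
  filter_upwards [hunit, t.open_baseSet.mem_nhds htu,
    eventually_mem_baseSet (F := F) hf.continuousAt] with y hy hyt hys
  have h1 : alongComp f (fun y => mfderiv 𝓘(ℝ, E) 𝓘(ℝ, F) f y (Y y)) u y =
      Φ y (t ⟨y, Y y⟩).2 := by
    have h2 : Φ y (t ⟨y, Y y⟩).2 = s.continuousLinearMapAt ℝ (f y)
        (mfderiv 𝓘(ℝ, E) 𝓘(ℝ, F) f y (t.symmL ℝ y (t ⟨y, Y y⟩).2)) := rfl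
    rw [h2, Trivialization.symmL_apply _ hyt, Trivialization.symm_apply_apply_mk _ hyt,
      Trivialization.continuousLinearMapAt_apply, Trivialization.linearMapAt_apply, if_pos hys]
    rfl
  rw [h1]
  exact (hy.inverse_apply_eq.2 rfl).symm

lemma SmoothFieldNear.of_mfderiv_apply [FiniteDimensional ℝ F]
    (hf : ContMDiff 𝓘(ℝ, E) 𝓘(ℝ, F) ∞ f)
    (hinj : ∀ u, Function.Injective (mfderiv 𝓘(ℝ, E) 𝓘(ℝ, F) f u))
    (hY : SmoothAlongNear (E := E) f (fun y => mfderiv 𝓘(ℝ, E) 𝓘(ℝ, F) f y (Y y)) u) :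
    SmoothFieldNear Y u := by
  filter_upwards [hY] with y hy
  exact contMDiffAt_of_mfderiv_apply hf.contMDiffAt (hinj y) hy

end

/-! ### The splitting into tangential and transversal parts. -/

section

variable {E : Type*} [NormedAddCommGroup E] [NormedSpace ℝ E]
  {M : Type*} [TopologicalSpace M] [ChartedSpace E M] [IsManifold 𝓘(ℝ, E) ∞ M]
  {F : Type*} [NormedAddCommGroup F] [NormedSpace ℝ F]
  {N : Type*} [TopologicalSpace N] [ChartedSpace F N] [IsManifold 𝓘(ℝ, F) ∞ N]
  {g : SemiRiemannianMetric F N} {f : M → N}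
  {S : Π u : M, Submodule ℝ (TangentSpace 𝓘(ℝ, E) u)} {u : M}
  {ξ : TangentSpace 𝓘(ℝ, E) u} {n : TangentSpace 𝓘(ℝ, F) (f u)}

lemma IsLightlikeHypersurface.exists_eq_smul_of_mem_radical (hf : IsLightlikeHypersurface (E := E) g f)
    {ξ x : TangentSpace 𝓘(ℝ, E) u} (hξ : ξ ∈ radical g f u) (hξ0 : ξ ≠ 0)
    (hx : x ∈ radical g f u) : ∃ b : ℝ, x = b • ξ := by
  obtain ⟨U, -, huU, X, -, hX⟩ := hf.radical_rank_one u
  have hspan : _ = radical g f u := (hX u huU).2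
  rw [Set.range_unique] at hspan
  rw [← hspan, Submodule.mem_span_singleton] at hξ hx
  obtain ⟨a, rfl⟩ := hξ
  obtain ⟨b, rfl⟩ := hx
  have ha : a ≠ 0 := by rintro rfl; simp at hξ0
  exact ⟨b / a, by rw [smul_smul, div_mul_cancel₀ _ ha]⟩

variable [FiniteDimensional ℝ F]

/-- The image of df lies in the orthogonal complement of df(ξ), a hyperplane because g(n, ξ) = 1.
Codimension one makes the two equal, and the right-hand side is orthogonal to df(ξ). -/
lemma IsNormalizingPairAt.exists_sub_eq_mfderiv (hf : IsLightlikeHypersurface (E := E) g f)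
    (hp : IsNormalizingPairAt g f S u ξ n) (w : TangentSpace 𝓘(ℝ, F) (f u)) :
    ∃ x : TangentSpace 𝓘(ℝ, E) u, mfderiv 𝓘(ℝ, E) 𝓘(ℝ, F) f u x =
      w - g.val (f u) w (mfderiv 𝓘(ℝ, E) 𝓘(ℝ, F) f u ξ) • n := by
  let φ : TangentSpace 𝓘(ℝ, F) (f u) →ₗ[ℝ] ℝ :=
    (g.val (f u) (mfderiv 𝓘(ℝ, E) 𝓘(ℝ, F) f u ξ)).toLinearMap
  let d : TangentSpace 𝓘(ℝ, E) u →ₗ[ℝ] TangentSpace 𝓘(ℝ, F) (f u) :=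
    (mfderiv 𝓘(ℝ, E) 𝓘(ℝ, F) f u).toLinearMap
  have hφ : ∀ v, φ v = g.val (f u) v (mfderiv 𝓘(ℝ, E) 𝓘(ℝ, F) f u ξ) := fun v => g.symm _ _ _
  have hφ0 : φ ≠ 0 := by
    intro h
    have h1 := hφ n
    rw [h, hp.pairing] at h1
    exact zero_ne_one h1
  have hle : LinearMap.range d ≤ LinearMap.ker φ := by
    rintro _ ⟨x, rfl⟩
    exact hp.mem_radical x
  have hr : Module.finrank ℝ (LinearMap.range d) = Module.finrank ℝ E :=
    LinearMap.finrank_range_of_inj (hf.immersion u)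
  have hk := Module.Dual.finrank_ker_add_one_of_ne_zero hφ0
  have hF : Module.finrank ℝ (TangentSpace 𝓘(ℝ, F) (f u)) = Module.finrank ℝ E + 1 := hf.codim_one
  have heq := Submodule.eq_of_le_of_finrank_eq hle (by omega)
  have hw : w - g.val (f u) w (mfderiv 𝓘(ℝ, E) 𝓘(ℝ, F) f u ξ) • n ∈ LinearMap.range d := by
    rw [heq, LinearMap.mem_ker, map_sub, map_smul, hφ, hφ, hp.pairing]
    simp
  exact hw

/-- Write n' = df(x) + a n. Then x is orthogonal to the radical and to the screen, so x = bξ, and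
nullity of n' reads 2ab = 0 with a ≠ 0. Consequently the span defining `transversal` is a line. -/
lemma IsNormalizingPairAt.eq_smul (hf : IsLightlikeHypersurface (E := E) g f)
    (hS : IsScreen g f S) (hp : IsNormalizingPairAt g f S u ξ n)
    {ξ' : TangentSpace 𝓘(ℝ, E) u} {n' : TangentSpace 𝓘(ℝ, F) (f u)}
    (hp' : IsNormalizingPairAt g f S u ξ' n') : ∃ a : ℝ, n' = a • n := by
  obtain ⟨x, hx⟩ := hp.exists_sub_eq_mfderiv hf n'
  set a := g.val (f u) n' (mfderiv 𝓘(ℝ, E) 𝓘(ℝ, F) f u ξ) with ha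
  have hn' : n' = mfderiv 𝓘(ℝ, E) 𝓘(ℝ, F) f u x + a • n := by rw [hx]; abel
  have hrad : x ∈ radical g f u := by
    intro y
    obtain ⟨r, hr, s, hs, rfl⟩ := Submodule.mem_sup.1
      ((hS.2 u).sup_eq_top ▸ Submodule.mem_top : y ∈ radical g f u ⊔ S u)
    have h1 : indMetric g f u x r = 0 := by
      rw [indMetric, g.symm]; exact hr x
    have h2 : indMetric g f u x s = 0 := by
      rw [indMetric, hx, map_sub, map_smul, sub_apply, smul_apply, hp'.orthogonal s hs,
        hp.orthogonal s hs, smul_zero, sub_zero]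
    simp only [indMetric, map_add] at h1 h2 ⊢
    rw [h1, h2, add_zero]
  have hξ0 : ξ ≠ 0 := by
    rintro rfl
    have := hp.pairing
    simp at this
  obtain ⟨b, rfl⟩ := hf.exists_eq_smul_of_mem_radical hp.mem_radical hξ0 hrad
  have ha0 : a ≠ 0 := by
    intro h0
    have h1 := hp'.pairing
    rw [hn', h0, zero_smul, add_zero] at h1
    have h2 := hrad ξ'
    rw [indMetric] at h2
    rw [h2] at h1
    exact zero_ne_one h1
  have hξξ : g.val (f u) (mfderiv 𝓘(ℝ, E) 𝓘(ℝ, F) f u ξ) (mfderiv 𝓘(ℝ, E) 𝓘(ℝ, F) f u ξ) = 0 :=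
    hp.mem_radical ξ
  have h1 := hp'.null
  rw [hn'] at h1
  simp only [map_add, map_smul, add_apply, smul_apply, smul_eq_mul, hp.null, hξξ,
    hp.pairing, g.symm (f u) (mfderiv 𝓘(ℝ, E) 𝓘(ℝ, F) f u ξ) n] at h1
  have hb : b = 0 := by
    have h2 : a * b = 0 := by linarith
    exact (mul_eq_zero.1 h2).resolve_left ha0
  exact ⟨a, by rw [hn', hb]; simp⟩

/-- The decomposition of an ambient tangent vector into its tangential and transversal parts. -/
theorem IsNormalizingPairAt.exists_tanPart_eq (hf : IsLightlikeHypersurface (E := E) g f)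
    (hS : IsScreen g f S) (hp : IsNormalizingPairAt g f S u ξ n) :
    ∃ T : TangentSpace 𝓘(ℝ, F) (f u) →ₗ[ℝ] TangentSpace 𝓘(ℝ, E) u,
      (∀ w, tanPart g f S u w = T w) ∧
      ∀ w, mfderiv 𝓘(ℝ, E) 𝓘(ℝ, F) f u (T w) =
        w - g.val (f u) w (mfderiv 𝓘(ℝ, E) 𝓘(ℝ, F) f u ξ) • n := by
  have key : ∀ w, mfderiv 𝓘(ℝ, E) 𝓘(ℝ, F) f u (tanPart g f S u w) =
      w - g.val (f u) w (mfderiv 𝓘(ℝ, E) 𝓘(ℝ, F) f u ξ) • n := by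
    intro w
    have hspan : transversal g f S u ≤ Submodule.span ℝ {n} := by
      refine Submodule.span_le.2 ?_
      rintro n' ⟨ξ', hp'⟩
      obtain ⟨a, rfl⟩ := hp.eq_smul hf hS hp'
      exact Submodule.smul_mem _ _ (Submodule.mem_span_singleton_self n)
    have hex : ∃ x, w - mfderiv 𝓘(ℝ, E) 𝓘(ℝ, F) f u x ∈ transversal g f S u := by
      obtain ⟨x, hx⟩ := hp.exists_sub_eq_mfderiv hf w
      refine ⟨x, ?_⟩
      rw [hx, sub_sub_cancel]
      exact Submodule.smul_mem _ _ (Submodule.subset_span ⟨ξ, hp⟩)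
    obtain ⟨a, ha⟩ := Submodule.mem_span_singleton.1 (hspan (Classical.epsilon_spec hex))
    change a • n = w - mfderiv 𝓘(ℝ, E) 𝓘(ℝ, F) f u (tanPart g f S u w) at ha
    -- Pairing with ξ kills the tangential part and determines the coefficient of n, so the choice
    -- in `tanPart` is forced and linear.
    have h1 : g.val (f u) (mfderiv 𝓘(ℝ, E) 𝓘(ℝ, F) f u (tanPart g f S u w))
        (mfderiv 𝓘(ℝ, E) 𝓘(ℝ, F) f u ξ) = 0 := by
      rw [g.symm]; exact hp.mem_radical _
    have h2 := congrArg (fun v => g.val (f u) v (mfderiv 𝓘(ℝ, E) 𝓘(ℝ, F) f u ξ)) ha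
    simp only [map_smul, map_sub, smul_apply, sub_apply, h1, hp.pairing, smul_eq_mul, mul_one,
      sub_zero] at h2
    rw [← h2, ha, sub_sub_cancel]
  refine ⟨{ toFun := tanPart g f S u, map_add' := fun v w => ?_, map_smul' := fun t w => ?_ },
    fun w => rfl, key⟩
  · apply hf.immersion u
    rw [map_add, key, key, key, map_add, add_apply]
    module
  · apply hf.immersion u
    rw [RingHom.id_apply, map_smul, key, key, map_smul, smul_apply, smul_eq_mul]
    module

end

/-! ### Gauss formula and Gauss equation. -/

section

variable {E : Type*} [NormedAddCommGroup E] [NormedSpace ℝ E]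
  {M : Type*} [TopologicalSpace M] [ChartedSpace E M] [IsManifold 𝓘(ℝ, E) ∞ M]
  {F : Type*} [NormedAddCommGroup F] [NormedSpace ℝ F]
  {N : Type*} [TopologicalSpace N] [ChartedSpace F N] [IsManifold 𝓘(ℝ, F) ∞ N]
  {g : SemiRiemannianMetric F N} {D : Connection F N} {f : M → N}
  {S : Π u : M, Submodule ℝ (TangentSpace 𝓘(ℝ, E) u)} {u : M}

/-- The image `df(X)` of a vector field `X`, as a vector field along `f`. -/
abbrev pushAlong (f : M → N) (X : VField E M) : Π u : M, TangentSpace 𝓘(ℝ, F) (f u) :=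
  fun y => mfderiv 𝓘(ℝ, E) 𝓘(ℝ, F) f y (X y)

/-- Smoothness of a local normalizing pair. -/
structure IsNormalizingPairNear (g : SemiRiemannianMetric F N) (f : M → N)
    (S : Π u : M, Submodule ℝ (TangentSpace 𝓘(ℝ, E) u)) (ξ : VField E M)
    (n : Π u : M, TangentSpace 𝓘(ℝ, F) (f u)) (u : M) : Prop where
  smooth_radical : SmoothFieldNear ξ u
  smooth_transversal : SmoothAlongNear (E := E) f n u
  pair : ∀ᶠ y in 𝓝 u, IsNormalizingPairAt g f S y (ξ y) (n y)

lemma ShapeXiNonNull.exists_near (hA : ShapeXiNonNull g D f S) (u : M) :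
    ∃ (ξ : VField E M) (n : Π u : M, TangentSpace 𝓘(ℝ, F) (f u)),
      IsNormalizingPairNear g f S ξ n u ∧
      indMetric g f u (shapeOp g D f S n u (ξ u)) (shapeOp g D f S n u (ξ u)) ≠ 0 := by
  obtain ⟨U, hU, huU, ξ, n, hξ, hn, h⟩ := hA u
  have hU' : ∀ᶠ y in 𝓝 u, y ∈ U := hU.mem_nhds huU
  refine ⟨ξ, n, ⟨?_, ?_, ?_⟩, (h u huU).2⟩
  · filter_upwards [hU'] with y hy
    exact (hξ y hy).contMDiffAt (hU.mem_nhds hy)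
  · filter_upwards [hU'] with y hy
    exact (hn y hy).contMDiffAt (hU.mem_nhds hy)
  · filter_upwards [hU'] with y hy
    exact (h y hy).1

variable {ξ : VField E M} {n : Π u : M, TangentSpace 𝓘(ℝ, F) (f u)} {X Y Z W : VField E M}

lemma IsNormalizingPairNear.metric_radical_self (hp : IsNormalizingPairNear g f S ξ n u) :
    ∀ᶠ y in 𝓝 u, g.val (f y) (pushAlong f ξ y) (pushAlong f ξ y) = 0 := by
  filter_upwards [hp.pair] with y hy
  exact hy.mem_radical _

variable [FiniteDimensional ℝ F]

/-- The Gauss formula. -/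
lemma IsNormalizingPairNear.gauss (hf : IsLightlikeHypersurface (E := E) g f)
    (hS : IsScreen g f S) (hp : IsNormalizingPairNear g f S ξ n u) (X Y : VField E M) :
    ∀ᶠ y in 𝓝 u, pushAlong f (indConn g D f S X Y) y =
      covAlong D f (pushAlong f Y) y (X y) -
        g.val (f y) (covAlong D f (pushAlong f Y) y (X y)) (pushAlong f ξ y) • n y := by
  filter_upwards [hp.pair] with y hy
  obtain ⟨T, hT, hT'⟩ := hy.exists_tanPart_eq hf hS
  exact (congrArg _ (hT _)).trans (hT' _)

variable [T2Space N]

/-- The second fundamental form vanishes on the radical. -/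
lemma IsNormalizingPairNear.secondForm_radical_right (hD : IsLeviCivita g D)
    (hf : IsLightlikeHypersurface (E := E) g f) (hp : IsNormalizingPairNear g f S ξ n u)
    (x : TangentSpace 𝓘(ℝ, E) u) :
    g.val (f u) (covAlong D f (pushAlong f ξ) u x) (pushAlong f ξ u) = 0 := by
  have hξ := hp.smooth_radical.mfderiv_apply hf.smooth
  -- Differentiate g(ξ, ξ) = 0.
  have h1 := hD.mvfderiv_metric_along hf.smooth hξ hξ x
  rw [mvfderiv_fun_const_near hp.metric_radical_self, zero_apply,
    g.symm _ _ (covAlong D f _ u x)] at h1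
  change g.val (f u) (covAlong D f (fun y => mfderiv 𝓘(ℝ, E) 𝓘(ℝ, F) f y (ξ y)) u x)
    (mfderiv 𝓘(ℝ, E) 𝓘(ℝ, F) f u (ξ u)) = 0
  linarith

/-- D_ξ Z - D_Z ξ = [ξ, Z] is tangent to M, hence orthogonal to ξ, so this case follows from the
vanishing of g(D_Z ξ, ξ). -/
lemma IsNormalizingPairNear.secondForm_radical_left [FiniteDimensional ℝ E] (hD : IsLeviCivita g D)
    (hf : IsLightlikeHypersurface (E := E) g f) (hp : IsNormalizingPairNear g f S ξ n u)
    (hZ : SmoothFieldNear Z u) :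
    g.val (f u) (covAlong D f (pushAlong f Z) u (ξ u)) (pushAlong f ξ u) = 0 := by
  have : CompleteSpace E := FiniteDimensional.complete ℝ E
  have h1 := hD.torsion_free_along hf.smooth hp.smooth_radical hZ
  have h2 := congrArg (fun v => g.val (f u) v (pushAlong f ξ u)) h1
  simp only [map_sub, sub_apply] at h2
  have h3 : g.val (f u) (mfderiv 𝓘(ℝ, E) 𝓘(ℝ, F) f u (VectorField.mlieBracket 𝓘(ℝ, E) ξ Z u))
      (pushAlong f ξ u) = 0 := by
    rw [g.symm]; exact hp.pair.self_of_nhds.mem_radical _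
  rw [h3, hp.secondForm_radical_right hD hf, sub_zero] at h2
  exact h2.symm

/-- The covariant derivative of the Gauss formula. -/
lemma IsNormalizingPairNear.covAlong_gauss (hD : IsLeviCivita g D)
    (hf : IsLightlikeHypersurface (E := E) g f)
    (hS : IsScreen g f S) (hp : IsNormalizingPairNear g f S ξ n u) (hY : SmoothFieldNear Y u)
    (hZ : SmoothFieldNear Z u) (x : TangentSpace 𝓘(ℝ, E) u) :
    ∃ t : ℝ, covAlong D f (pushAlong f (indConn g D f S Y Z)) u x =
      covAlong D f (fun y => covAlong D f (pushAlong f Z) y (Y y)) u x -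
        g.val (f u) (covAlong D f (pushAlong f Z) u (Y u)) (pushAlong f ξ u) •
          covAlong D f n u x + t • n u := by
  have hV := (hZ.mfderiv_apply hf.smooth).covAlong_apply hD.smooth hf.smooth hY
  have hB := hV.metric g (hp.smooth_radical.mfderiv_apply hf.smooth)
  have hB' : SmoothFunNear (E := E) (fun y => -g.val (f y)
      (covAlong D f (pushAlong f Z) y (Y y)) (pushAlong f ξ y)) u := by
    filter_upwards [hB] with y hy
    exact hy.neg
  -- The coefficient is the derivative of -B(Y,Z). Its value is irrelevant later, since the
  -- tangential projection kills n.
  refine ⟨mvfderiv 𝓘(ℝ, E) (fun y => -g.val (f y)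
      (covAlong D f (pushAlong f Z) y (Y y)) (pushAlong f ξ y)) u x, ?_⟩
  have h1 := covAlong_add (D := D) hV (hp.smooth_transversal.smul hB') x
  rw [covAlong_smul hB' hp.smooth_transversal] at h1
  refine (covAlong_congr ?_ x).trans (h1.trans ?_)
  · filter_upwards [hp.gauss (D := D) hf hS Y Z] with y hy
    rw [hy, Pi.add_apply, Pi.smul_apply', neg_smul, sub_eq_add_neg]
  · rw [neg_smul]
    abel

/-- The Gauss equation of a lightlike hypersurface of a manifold of constant curvature. -/
theorem IsNormalizingPairNear.gauss_equation [FiniteDimensional ℝ E] (hD : IsLeviCivita g D) {c : ℝ}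
    (hc : HasConstantSectionalCurvature g D c)
    (hf : IsLightlikeHypersurface (E := E) g f)
    (hS : IsScreen g f S) (hp : IsNormalizingPairNear g f S ξ n u) (hX : SmoothFieldNear X u)
    (hY : SmoothFieldNear Y u) (hZ : SmoothFieldNear Z u) :
    indCurv g D f S X Y Z u =
      c • (g.val (f u) (pushAlong f Y u) (pushAlong f Z u) • X u -
        g.val (f u) (pushAlong f X u) (pushAlong f Z u) • Y u) +
      g.val (f u) (covAlong D f (pushAlong f Z) u (Y u)) (pushAlong f ξ u) •
        shapeOp g D f S n u (X u) -
      g.val (f u) (covAlong D f (pushAlong f Z) u (X u)) (pushAlong f ξ u) •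
        shapeOp g D f S n u (Y u) := by
  have hpu := hp.pair.self_of_nhds
  obtain ⟨T, hT, hT'⟩ := hpu.exists_tanPart_eq hf hS
  have hTn : T (n u) = 0 := by
    apply hf.immersion u
    rw [hT', hpu.pairing, one_smul, sub_self, map_zero]
  have hTd : ∀ x, T (mfderiv 𝓘(ℝ, E) 𝓘(ℝ, F) f u x) = x := by
    intro x
    apply hf.immersion u
    have h1 : g.val (f u) (mfderiv 𝓘(ℝ, E) 𝓘(ℝ, F) f u x)
        (mfderiv 𝓘(ℝ, E) 𝓘(ℝ, F) f u (ξ u)) = 0 := by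
      rw [g.symm]; exact hpu.mem_radical x
    rw [hT', h1, zero_smul, sub_zero]
  -- The null vectors n and df(ξ) span a hyperbolic plane, with Gram determinant -1.
  have hnd : ∃ v w : TangentSpace 𝓘(ℝ, F) (f u),
      g.val (f u) v v * g.val (f u) w w - g.val (f u) v w ^ 2 ≠ 0 := by
    refine ⟨n u, mfderiv 𝓘(ℝ, E) 𝓘(ℝ, F) f u (ξ u), ?_⟩
    rw [hpu.null, hpu.pairing]
    norm_num
  obtain ⟨a, ha⟩ := hp.covAlong_gauss hD hf hS hY hZ (X u)
  obtain ⟨b, hb⟩ := hp.covAlong_gauss hD hf hS hX hZ (Y u)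
  have hK := congrArg T (hc.curvature_along hD hnd hf.smooth hX hY (hZ.mfderiv_apply hf.smooth))
  simp only [map_sub, map_smul, hTd] at hK
  have hR : indCurv g D f S X Y Z u =
      tanPart g f S u (covAlong D f (pushAlong f (indConn g D f S Y Z)) u (X u)) -
      tanPart g f S u (covAlong D f (pushAlong f (indConn g D f S X Z)) u (Y u)) -
      tanPart g f S u (covAlong D f (pushAlong f Z) u
        (VectorField.mlieBracket 𝓘(ℝ, E) X Y u)) := rfl
  rw [hR, shapeOp, shapeOp, hT, hT, hT, hT, hT, ha, hb]
  simp only [map_add, map_sub, map_smul, hTn, smul_zero, add_zero]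
  rw [← hK]
  module

end

/-! ### Vanishing of the second fundamental form. -/

section

variable {E : Type*} [NormedAddCommGroup E] [NormedSpace ℝ E] [FiniteDimensional ℝ E]
  {M : Type*} [TopologicalSpace M] [T2Space M] [ChartedSpace E M] [IsManifold 𝓘(ℝ, E) ∞ M]
  {F : Type*} [NormedAddCommGroup F] [NormedSpace ℝ F]
  {N : Type*} [TopologicalSpace N] [ChartedSpace F N] [IsManifold 𝓘(ℝ, F) ∞ N]
  {g : SemiRiemannianMetric F N} {D : Connection F N} {f : M → N}
  {S : Π u : M, Submodule ℝ (TangentSpace 𝓘(ℝ, E) u)} {u : M} {c : ℝ}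
  {ξ : VField E M} {n : Π u : M, TangentSpace 𝓘(ℝ, F) (f u)} {X Y Z W : VField E M}

lemma IsNormalizingPairNear.exists_smoothField_radical (hp : IsNormalizingPairNear g f S ξ n u) :
    ∃ ξ' : VField E M, SmoothField ξ' ∧ ξ' u = ξ u ∧ IsNormalizingPairNear g f S ξ' n u := by
  obtain ⟨ξ', h1, h2⟩ := hp.smooth_radical.exists_smoothField
  refine ⟨ξ', h1, h2.self_of_nhds, h1.near u, hp.smooth_transversal, ?_⟩
  filter_upwards [h2, hp.pair] with y hy hy'
  rwa [hy]

variable [FiniteDimensional ℝ F] [T2Space N]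

/-- The second fundamental form of an admissible screen with non-null `A_N ξ` vanishes. -/
theorem secondForm_eq_zero (hD : IsLeviCivita g D) (hc : HasConstantSectionalCurvature g D c)
    (hf : IsLightlikeHypersurface (E := E) g f) (hS : IsAdmissible g D f S)
    (hp : IsNormalizingPairNear g f S ξ n u)
    (hA : indMetric g f u (shapeOp g D f S n u (ξ u)) (shapeOp g D f S n u (ξ u)) ≠ 0)
    (hY : SmoothFieldNear Y u) (hZ : SmoothFieldNear Z u) :
    g.val (f u) (covAlong D f (pushAlong f Z) u (Y u)) (pushAlong f ξ u) = 0 := by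
  obtain ⟨ξ', hξ', hξu, hp'⟩ := hp.exists_smoothField_radical
  obtain ⟨Y', hY', hYe⟩ := hY.exists_smoothField
  obtain ⟨Z', hZ', hZe⟩ := hZ.exists_smoothField
  -- The test vector is A_N ξ itself, so that its non-null square appears as a factor.
  obtain ⟨W, hW, hWu⟩ := exists_smoothField_eq (shapeOp g D f S n u (ξ u))
  have hrad : ∀ x, g.val (f u) (mfderiv 𝓘(ℝ, E) 𝓘(ℝ, F) f u (ξ' u))
      (mfderiv 𝓘(ℝ, E) 𝓘(ℝ, F) f u x) = 0 := hp'.pair.self_of_nhds.mem_radical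
  have hrad' : ∀ x, g.val (f u) (mfderiv 𝓘(ℝ, E) 𝓘(ℝ, F) f u x)
      (mfderiv 𝓘(ℝ, E) 𝓘(ℝ, F) f u (ξ' u)) = 0 := fun x => by rw [g.symm]; exact hrad x
  -- Pair symmetry with the radical field in the first slot. After the Gauss equation one side is
  -- B(Y,Z) g(A_N ξ, A_N ξ), and the other is zero because R(Z,W)ξ vanishes.
  have h := congrFun (hS.pair_symm ξ' Y' Z' W hξ' hY' hZ' hW) u
  rw [indCurv4, indCurv4, hp'.gauss_equation hD hc hf hS.isScreen (hξ'.near u) (hY'.near u)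
    (hZ'.near u), hp'.gauss_equation hD hc hf hS.isScreen (hZ'.near u) (hW.near u) (hξ'.near u),
    hp'.secondForm_radical_left hD hf (hZ'.near u), hp'.secondForm_radical_right hD hf,
    hp'.secondForm_radical_right hD hf] at h
  simp only [indMetric, pushAlong, hrad', zero_smul, sub_self, smul_zero, add_zero, sub_zero,
    map_zero, zero_apply, map_add, map_smul, add_apply, smul_apply, hrad, smul_eq_mul, mul_zero,
    zero_add] at h
  rw [hWu, hξu] at h
  have h0 := (mul_eq_zero.1 (by simpa [indMetric] using h)).resolve_right hA
  have hZcov : covAlong D f (pushAlong f Z) u (Y u) = covAlong D f (pushAlong f Z') u (Y' u) := by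
    rw [hYe.self_of_nhds]
    refine covAlong_congr ?_ _
    filter_upwards [hZe] with y hy
    rw [pushAlong, pushAlong, hy]
  rw [hZcov]
  exact h0

end

/-! ### Constant induced curvature, semi-symmetry and local symmetry. -/

section

variable {E : Type*} [NormedAddCommGroup E] [NormedSpace ℝ E]
  {M : Type*} [TopologicalSpace M] [ChartedSpace E M]
  {F : Type*} [NormedAddCommGroup F] [NormedSpace ℝ F]
  {N : Type*} [TopologicalSpace N] [ChartedSpace F N] [IsManifold 𝓘(ℝ, F) ∞ N]
  {f : M → N} {u : M}

lemma SmoothFunNear.const_mul {a : M → ℝ} (ha : SmoothFunNear (E := E) a u) (t : ℝ) :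
    SmoothFunNear (E := E) (fun y => t * a y) u := by
  filter_upwards [ha] with y hy
  exact contMDiffAt_const.mul hy

variable [IsManifold 𝓘(ℝ, E) ∞ M] {g : SemiRiemannianMetric F N} {D : Connection F N}
  {S : Π u : M, Submodule ℝ (TangentSpace 𝓘(ℝ, E) u)} {c : ℝ} {X Y Z W : VField E M}

lemma SmoothFieldNear.smooth_indMetric (g : SemiRiemannianMetric F N)
    (hf : ContMDiff 𝓘(ℝ, E) 𝓘(ℝ, F) ∞ f) (hX : SmoothFieldNear X u) (hY : SmoothFieldNear Y u) :
    SmoothFunNear (E := E) (fun y => indMetric g f y (X y) (Y y)) u :=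
  (hX.mfderiv_apply hf).metric g (hY.mfderiv_apply hf)

/-- The second fundamental form of the hypersurface vanishes. -/
def IsTotallyGeodesic (g : SemiRiemannianMetric F N) (D : Connection F N) (f : M → N)
    (S : Π u : M, Submodule ℝ (TangentSpace 𝓘(ℝ, E) u)) : Prop :=
  ∀ (u : M) (Y Z : VField E M), SmoothFieldNear Y u → SmoothFieldNear Z u →
    mfderiv 𝓘(ℝ, E) 𝓘(ℝ, F) f u (indConn g D f S Y Z u) =
      covAlong D f (fun y => mfderiv 𝓘(ℝ, E) 𝓘(ℝ, F) f y (Z y)) u (Y u)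

/-- The induced curvature operator is that of a space of constant curvature `c`. -/
def HasConstantIndCurv (g : SemiRiemannianMetric F N) (D : Connection F N) (f : M → N)
    (S : Π u : M, Submodule ℝ (TangentSpace 𝓘(ℝ, E) u)) (c : ℝ) : Prop :=
  ∀ (u : M) (X Y Z : VField E M), SmoothFieldNear X u → SmoothFieldNear Y u →
    SmoothFieldNear Z u → indCurv g D f S X Y Z u =
      c • (indMetric g f u (Y u) (Z u) • X u - indMetric g f u (X u) (Z u) • Y u)

/-- Both symmetry conditions differentiate curvature fields or insert them into R, and the curvature
formula applies only to smooth fields. -/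
lemma HasConstantIndCurv.smooth_indCurv (hR : HasConstantIndCurv g D f S c)
    (hf : IsLightlikeHypersurface (E := E) g f) (hX : SmoothFieldNear X u)
    (hY : SmoothFieldNear Y u) (hZ : SmoothFieldNear Z u) :
    SmoothFieldNear (indCurv g D f S X Y Z) u := by
  have h1 := ((hY.smooth_indMetric g hf.smooth hZ).const_mul c)
  have h2 := ((hX.smooth_indMetric g hf.smooth hZ).const_mul (-c))
  have h3 : SmoothAlongNear (E := E) id ((fun y => c * indMetric g f y (Y y) (Z y)) • X +
      (fun y => -c * indMetric g f y (X y) (Z y)) • Y) u :=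
    SmoothAlongNear.add (SmoothAlongNear.smul (f := id) h1 hX)
      (SmoothAlongNear.smul (f := id) h2 hY)
  refine h3.congr ?_
  filter_upwards [hX.eventually, hY.eventually, hZ.eventually] with y hXy hYy hZy
  rw [hR y X Y Z hXy hYy hZy, Pi.add_apply, Pi.smul_apply', Pi.smul_apply']
  module

/-- R(V₁,V₂) is skew for g and R is built from g alone, so R(V₁,V₂) acts on it by zero. -/
theorem isSemiSymmetric_of_hasConstantIndCurv (hR : HasConstantIndCurv g D f S c)
    (hf : IsLightlikeHypersurface (E := E) g f) : IsSemiSymmetric g D f S := by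
  intro V₁ V₂ X Y Z T hV₁ hV₂ hX hY hZ hT
  ext1 u
  have hcurv : ∀ {X : VField E M}, SmoothField X → SmoothFieldNear (indCurv g D f S V₁ V₂ X) u :=
    fun hX => hR.smooth_indCurv hf (hV₁.near u) (hV₂.near u) (hX.near u)
  simp only [Pi.sub_apply, Pi.neg_apply, Pi.zero_apply, indCurv4]
  rw [hR u _ Y Z (hcurv hX) (hY.near u) (hZ.near u), hR u X _ Z (hX.near u) (hcurv hY) (hZ.near u),
    hR u X Y _ (hX.near u) (hY.near u) (hcurv hZ), hR u X Y Z (hX.near u) (hY.near u) (hZ.near u),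
    hR u V₁ V₂ X (hV₁.near u) (hV₂.near u) (hX.near u),
    hR u V₁ V₂ Y (hV₁.near u) (hV₂.near u) (hY.near u),
    hR u V₁ V₂ Z (hV₁.near u) (hV₂.near u) (hZ.near u),
    hR u V₁ V₂ T (hV₁.near u) (hV₂.near u) (hT.near u)]
  have hs : ∀ x y, indMetric (E := E) g f u x y = indMetric g f u y x :=
    fun x y => g.symm _ _ _
  have hsub : ∀ x y z, indMetric (E := E) g f u (x - y) z =
      indMetric g f u x z - indMetric g f u y z := by
    intro x y z; simp [indMetric]
  have hsmul : ∀ (t : ℝ) x z, indMetric (E := E) g f u (t • x) z =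
      t * indMetric g f u x z := by
    intro t x z; simp [indMetric]
  have hsub' : ∀ x y z, indMetric (E := E) g f u z (x - y) =
      indMetric g f u z x - indMetric g f u z y := by
    intro x y z; simp [indMetric]
  have hsmul' : ∀ (t : ℝ) x z, indMetric (E := E) g f u z (t • x) =
      t * indMetric g f u z x := by
    intro t x z; simp [indMetric]
  simp only [hsub, hsmul, hsub', hsmul']
  rw [hs (X u) (V₁ u), hs (X u) (V₂ u), hs (Y u) (V₁ u), hs (Y u) (V₂ u)]
  ring

variable [FiniteDimensional ℝ E] [FiniteDimensional ℝ F] [T2Space N]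

theorem isTotallyGeodesic_of_shapeXiNonNull [T2Space M] (hD : IsLeviCivita g D)
    (hc : HasConstantSectionalCurvature g D c) (hf : IsLightlikeHypersurface (E := E) g f)
    (hS : IsAdmissible g D f S) (hA : ShapeXiNonNull g D f S) : IsTotallyGeodesic g D f S := by
  intro u Y Z hY hZ
  obtain ⟨ξ, n, hp, hne⟩ := hA.exists_near u
  refine ((hp.gauss (D := D) hf hS.isScreen Y Z).self_of_nhds).trans ?_
  rw [secondForm_eq_zero hD hc hf hS hp hne hY hZ, zero_smul, sub_zero]

/-- With B = 0 the shape operator terms of the Gauss equation disappear. -/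
theorem hasConstantIndCurv_of_shapeXiNonNull [T2Space M] (hD : IsLeviCivita g D)
    (hc : HasConstantSectionalCurvature g D c) (hf : IsLightlikeHypersurface (E := E) g f)
    (hS : IsAdmissible g D f S) (hA : ShapeXiNonNull g D f S) :
    HasConstantIndCurv g D f S c := by
  intro u X Y Z hX hY hZ
  obtain ⟨ξ, n, hp, hne⟩ := hA.exists_near u
  rw [hp.gauss_equation hD hc hf hS.isScreen hX hY hZ,
    secondForm_eq_zero hD hc hf hS hp hne hX hZ, secondForm_eq_zero hD hc hf hS hp hne hY hZ,
    zero_smul, zero_smul, add_zero, sub_zero]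
  rfl

/-- The image of ∇_X Y under df is the ambient derivative of df(Y), which is smooth along f; the
immersion lifts this back to M. -/
lemma IsTotallyGeodesic.smooth_indConn (hG : IsTotallyGeodesic g D f S) (hD : IsLeviCivita g D)
    (hf : IsLightlikeHypersurface (E := E) g f) (hX : SmoothFieldNear X u)
    (hY : SmoothFieldNear Y u) : SmoothFieldNear (indConn g D f S X Y) u := by
  refine SmoothFieldNear.of_mfderiv_apply hf.smooth hf.immersion ?_
  refine ((hY.mfderiv_apply hf.smooth).covAlong_apply hD.smooth hf.smooth hX).congr ?_
  filter_upwards [hX.eventually, hY.eventually] with y hy hy'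
  exact (hG y X Y hy hy').symm

/-- The induced connection is the restriction of the ambient one, so it makes g parallel; R, being
assembled from g and the identity with a constant factor, is parallel too. The computation is done
in the ambient tangent space, after applying the injective df. -/
theorem isLocallySymmetric_of_isTotallyGeodesic (hG : IsTotallyGeodesic g D f S)
    (hR : HasConstantIndCurv g D f S c) (hD : IsLeviCivita g D)
    (hf : IsLightlikeHypersurface (E := E) g f) : IsLocallySymmetric g D f S := by
  intro W X Y Z hW hX hY hZ
  ext1 u
  have hn : ∀ {X : VField E M}, SmoothField X → SmoothFieldNear X u := fun hX => hX.near u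
  apply hf.immersion u
  simp only [Pi.sub_apply, Pi.zero_apply, map_sub, map_zero]
  rw [hG u W _ (hn hW) (hR.smooth_indCurv hf (hn hX) (hn hY) (hn hZ)),
    hR u _ Y Z (hG.smooth_indConn hD hf (hn hW) (hn hX)) (hn hY) (hn hZ),
    hR u X _ Z (hn hX) (hG.smooth_indConn hD hf (hn hW) (hn hY)) (hn hZ),
    hR u X Y _ (hn hX) (hn hY) (hG.smooth_indConn hD hf (hn hW) (hn hZ))]
  have h1 := ((hn hY).smooth_indMetric g hf.smooth (hn hZ)).const_mul c
  have h2 := ((hn hX).smooth_indMetric g hf.smooth (hn hZ)).const_mul (-c)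
  have hX' := (hn hX).mfderiv_apply hf.smooth
  have hY' := (hn hY).mfderiv_apply hf.smooth
  have hZ' := (hn hZ).mfderiv_apply hf.smooth
  have h3 : covAlong D f (fun y => mfderiv 𝓘(ℝ, E) 𝓘(ℝ, F) f y (indCurv g D f S X Y Z y)) u (W u) =
      _ := (covAlong_congr ?_ _).trans (covAlong_add (hX'.smul h1) (hY'.smul h2) (W u))
  · rw [h3, covAlong_smul h1 hX', covAlong_smul h2 hY']
    -- Compatibility of the induced connection with g, in the form in which the coefficients of R
    -- are differentiated.
    have h4 : ∀ (t : ℝ) {A B : VField E M}, SmoothField A → SmoothField B →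
        mvfderiv 𝓘(ℝ, E) (fun y => t * indMetric g f y (A y) (B y)) u (W u) =
          t * (indMetric g f u (indConn g D f S W A u) (B u) +
            indMetric g f u (A u) (indConn g D f S W B u)) := by
      intro t A B hA hB
      have h5 := mvfderiv_smul_apply (a := fun _ : M => t) mdifferentiableAt_const
        ((hn hA).smooth_indMetric g hf.smooth (hn hB)).mdiff (W u)
      rw [mvfderiv_const] at h5
      refine h5.trans ?_
      have h6 := hD.mvfderiv_metric_along hf.smooth ((hn hA).mfderiv_apply hf.smooth)
        ((hn hB).mfderiv_apply hf.smooth) (W u)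
      rw [← hG u W A (hn hW) (hn hA), ← hG u W B (hn hW) (hn hB)] at h6
      rw [zero_apply, zero_smul, add_zero, smul_eq_mul]
      exact congrArg (t * ·) h6
    rw [h4 c hY hZ, h4 (-c) hX hZ, ← hG u W X (hn hW) (hn hX), ← hG u W Y (hn hW) (hn hY)]
    simp only [map_smul, map_sub]
    module
  · filter_upwards with y
    rw [hR y X Y Z (hX.near y) (hY.near y) (hZ.near y), Pi.add_apply, Pi.smul_apply',
      Pi.smul_apply', map_smul, map_sub, map_smul, map_smul]
    module

end

end LightlikeGeometry

end

theorem corollary5p4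
    {E : Type*} [NormedAddCommGroup E] [NormedSpace ℝ E] [FiniteDimensional ℝ E]
    {M : Type*} [TopologicalSpace M] [T2Space M] [ChartedSpace E M]
    [IsManifold 𝓘(ℝ, E) ∞ M]
    {F : Type*} [NormedAddCommGroup F] [NormedSpace ℝ F] [FiniteDimensional ℝ F]
    {N : Type*} [TopologicalSpace N] [T2Space N] [ChartedSpace F N]
    [IsManifold 𝓘(ℝ, F) ∞ N]
    (g : LightlikeGeometry.SemiRiemannianMetric F N)
    (D : LightlikeGeometry.Connection F N) (hD : LightlikeGeometry.IsLeviCivita g D)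
    (c : ℝ) (hc : LightlikeGeometry.HasConstantSectionalCurvature g D c)
    (f : M → N) (hf : LightlikeGeometry.IsLightlikeHypersurface (E := E) g f)
    (hO : LightlikeGeometry.IsPointwiseOsserman (E := E) g D f)
    (S : Π u : M, Submodule ℝ (TangentSpace 𝓘(ℝ, E) u))
    (hS : LightlikeGeometry.IsAdmissible g D f S)
    (hA : LightlikeGeometry.ShapeXiNonNull g D f S) :
    LightlikeGeometry.IsLocallySymmetric g D f S ↔
      LightlikeGeometry.IsSemiSymmetric g D f S := by
  have hG := LightlikeGeometry.isTotallyGeodesic_of_shapeXiNonNull hD hc hf hS hA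
  have hR := LightlikeGeometry.hasConstantIndCurv_of_shapeXiNonNull hD hc hf hS hA
  -- Vanishing of B makes both sides true.
  exact iff_of_true (LightlikeGeometry.isLocallySymmetric_of_isTotallyGeodesic hG hR hD hf)
    (LightlikeGeometry.isSemiSymmetric_of_hasConstantIndCurv hR hf)
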